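/- Work over $\mathbb{C}$. Let $r\ge 2$, let $a_1\ge\cdots\ge a_r$ be integers, let $\mathcal{E}=\mathcal{O}_{\mathbb{P}^1}(a_1)\oplus\cdots\oplus\mathcal{O}_{\mathbb{P}^1}(a_r)$, and let $\ell\ge -1$ be an integer. For a morphism $\Phi:\mathcal{E}\to\mathcal{E}(2+\ell)$, call a coherent subsheaf $\mathcal{F}\subseteq\mathcal{E}$ *invariant* if $\Phi(\mathcal{F})\subseteq\mathcal{F}(2+\ell)$, and call the pair $(\mathcal{E},\Phi)$ *semistable* (resp. *stable*) if $\mu(\mathcal{F})\le\mu(\mathcal{E})$ (resp. $\mu(\mathcal{F})<\mu(\mathcal{E})$) for every invariant coherent subsheaf $0\subsetneq\mathcal{F}\subsetneq\mathcal{E}$, where $\mu=\deg/\operatorname{rank}$. A *subbundle* of $\mathcal{E}$ is a subsheaf $\mathcal{F}$ with $\mathcal{E}/\mathcal{F}$ locally free; it is *proper* if $0\ne\mathcal{F}\ne\mathcal{E}$. (i) If $(\mathcal{E},\Phi)$ is semistable for some $\Phi:\mathcal{E}\to\mathcal{E}(2+\ell)$, then $a_{i+1}\ge a_i-\ell-2$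 for all $1\le i\le r-1$. (ii) Conversely, suppose that $a_{i+1}\ge a_i-\ell-2$ for all $1\le i\le r-1$. Then there is a $\Phi:\mathcal{E}\to\mathcal{E}(2+\ell)$ for which $\mathcal{E}$ has no invariant proper subbundle, and for every such $\Phi$ the pair $(\mathcal{E},\Phi)$ is stable. The set of all $\Phi$ without invariant proper subbundle is a non-empty Zariski-open subset of the vector space $H^0(\mathcal{E}nd(\mathcal{E})(2+\ell))$. Moreover, it contains the $\Phi$ which, on the affine chart with coordinate $z=z_0/z_1$ and in the trivializations $z_1^{a_i}$ of the summands, is given by $e_1\mapsto e_2\mapsto\cdots\mapsto e_r\mapsto z\,e_1$, and the characteristic polynomial of this matrix is irreducible in $\mathbb{C}[z][t]$. -/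

import Mathlib

open Polynomial LaurentPolynomial

noncomputable section

/-!
Coherent sheaves on the complex projective line, described on its standard affine cover.

The line `ℙ¹` over `ℂ`, with homogeneous coordinates `z₀, z₁`, is covered by the affine lines
`U₀ = {z₁ ≠ 0} = Spec ℂ[z]` with `z = z₀ / z₁`, and `U₁ = {z₀ ≠ 0} = Spec ℂ[w]` with
`w = z₁ / z₀ = z⁻¹`, whose intersection is `U₀₁ = Spec ℂ[z, z⁻¹]`.
Both `ℂ[z]` and `ℂ[w]` are Mathlib's `ℂ[X]`, and `ℂ[z, z⁻¹]` is `ℂ[T;T⁻¹]`, so that the two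
restriction maps of the structure sheaf are `X ↦ T` and `X ↦ T⁻¹`.
A quasi-coherent sheaf is the datum of its modules of sections over `U₀`, `U₁` and `U₀₁` and of
the two restriction maps, which have to be localizations.

The bundle `E = 𝒪(a₁) ⊕ ⋯ ⊕ 𝒪(a_r)` is given by `a : Fin r → ℤ`. Its sections over `U₀`, `U₁`,
`U₀₁` are `ℂ[X]^r`, `ℂ[X]^r`, `ℂ[T;T⁻¹]^r`, through the trivializations `z₁ ^ aᵢ` of `𝒪(aᵢ)` on
`U₀` and on `U₀₁`, and `z₀ ^ aᵢ` on `U₁`.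
-/

namespace P1

/-- Restriction of functions from `U₀` to `U₀₁`: `f(z) ↦ f(z)`. -/
def fun0 : ℂ[X] →+* ℂ[T;T⁻¹] := Polynomial.toLaurent

/-- Restriction of functions from `U₁` to `U₀₁`: `g(w) ↦ g(z⁻¹)`. -/
def fun1 : ℂ[X] →+* ℂ[T;T⁻¹] :=
  (LaurentPolynomial.invert (R := ℂ) : ℂ[T;T⁻¹] →+* ℂ[T;T⁻¹]).comp Polynomial.toLaurent

/-- Restriction of sections of `⨁ᵢ 𝒪(aᵢ)` from `U₀` to `U₀₁`. -/
def res0 {r : ℕ} (v : Fin r → ℂ[X]) : Fin r → ℂ[T;T⁻¹] := fun i => fun0 (v i)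

/-- Restriction of sections of `⨁ᵢ 𝒪(aᵢ)` from `U₁` to `U₀₁`: the section `g(w) z₀ ^ a` of `𝒪(a)`
is `z ^ a g(z⁻¹) z₁ ^ a`. -/
def res1 {r : ℕ} (a : Fin r → ℤ) (v : Fin r → ℂ[X]) : Fin r → ℂ[T;T⁻¹] :=
  fun i => T (a i) * fun1 (v i)

/-- The splitting type of `E(n) = E ⊗ 𝒪(n)`, for `E = ⨁ᵢ 𝒪(aᵢ)`. -/
def twistType {r : ℕ} (a : Fin r → ℤ) (n : ℤ) : Fin r → ℤ := fun i => a i + n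

/-- The complex vector space of morphisms of `𝒪`-modules `⨁ᵢ 𝒪(aᵢ) → ⨁ⱼ 𝒪(bⱼ)`: an `𝒪`-linear map
over each of `U₀`, `U₁` and `U₀₁`, compatible with the restrictions. As global sections of a
sheaf `ℋom` are morphisms, `Hom a (twistType a n)` is `H⁰(ℰnd(E)(n)) = H⁰(ℋom(E, E(n)))`. -/
def Hom {r s : ℕ} (a : Fin r → ℤ) (b : Fin s → ℤ) :
    Submodule ℂ (((Fin r → ℂ[X]) →ₗ[ℂ[X]] (Fin s → ℂ[X])) ×
      ((Fin r → ℂ[X]) →ₗ[ℂ[X]] (Fin s → ℂ[X])) ×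
      ((Fin r → ℂ[T;T⁻¹]) →ₗ[ℂ[T;T⁻¹]] (Fin s → ℂ[T;T⁻¹]))) where
  carrier := {φ | (∀ v, φ.2.2 (res0 v) = res0 (φ.1 v)) ∧
    (∀ v, φ.2.2 (res1 a v) = res1 b (φ.2.1 v))}
  add_mem' := by
    rintro φ ψ ⟨h0, h1⟩ ⟨k0, k1⟩
    refine ⟨fun v => ?_, fun v => ?_⟩
    · ext1 i
      simp [h0, k0, res0]
    · ext1 i
      simp [h1, k1, res1, mul_add]
  zero_mem' := by
    refine ⟨fun v => ?_, fun v => ?_⟩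
    · ext1 i
      simp [res0]
    · ext1 i
      simp [res1]
  smul_mem' := by
    rintro c φ ⟨h0, h1⟩
    refine ⟨fun v => ?_, fun v => ?_⟩
    · ext1 i
      simp [h0, res0, fun0, Polynomial.smul_eq_C_mul, LaurentPolynomial.smul_eq_C_mul]
    · ext1 i
      simp [h1, res1, fun1, Polynomial.smul_eq_C_mul, LaurentPolynomial.smul_eq_C_mul]
      ring

/-- The map that a morphism induces on sections over `U₀`. -/
def Hom.on0 {r s : ℕ} {a : Fin r → ℤ} {b : Fin s → ℤ} (Φ : Hom a b) :
    (Fin r → ℂ[X]) →ₗ[ℂ[X]] (Fin s → ℂ[X]) := Φ.1.1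

/-- The map that a morphism induces on sections over `U₁`. -/
def Hom.on1 {r s : ℕ} {a : Fin r → ℤ} {b : Fin s → ℤ} (Φ : Hom a b) :
    (Fin r → ℂ[X]) →ₗ[ℂ[X]] (Fin s → ℂ[X]) := Φ.1.2.1

/-- A coherent subsheaf of `⨁ᵢ 𝒪(aᵢ)`: submodules of sections over `U₀` and over `U₁` that
generate the same submodule of sections over `U₀₁`. (Finite generation is automatic, as `ℂ[X]` is
Noetherian.) -/
@[ext]
structure Subsheaf {r : ℕ} (a : Fin r → ℤ) where
  /-- sections over `U₀` -/
  sec0 : Submodule ℂ[X] (Fin r → ℂ[X])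
  /-- sections over `U₁` -/
  sec1 : Submodule ℂ[X] (Fin r → ℂ[X])
  glue : Submodule.span ℂ[T;T⁻¹] (res0 '' (sec0 : Set (Fin r → ℂ[X]))) =
    Submodule.span ℂ[T;T⁻¹] (res1 a '' (sec1 : Set (Fin r → ℂ[X])))

lemma res1_eq_smul {r : ℕ} (a : Fin r → ℤ) (n : ℤ) (v : Fin r → ℂ[X]) :
    res1 (twistType a n) v = (T n : ℂ[T;T⁻¹]) • res1 a v := by
  ext1 i
  simp only [res1, twistType, Pi.smul_apply, smul_eq_mul, T_add]
  ring

lemma span_res0_top {r : ℕ} :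
    Submodule.span ℂ[T;T⁻¹] (res0 '' (Set.univ : Set (Fin r → ℂ[X]))) = ⊤ := by
  rw [eq_top_iff, ← (Pi.basisFun ℂ[T;T⁻¹] (Fin r)).span_eq, Submodule.span_le]
  rintro _ ⟨i, rfl⟩
  refine Submodule.subset_span ⟨Pi.single i 1, trivial, ?_⟩
  ext1 j
  by_cases h : j = i
  · subst h; simp [res0]
  · simp [res0, h]

lemma span_res1_top {r : ℕ} (a : Fin r → ℤ) :
    Submodule.span ℂ[T;T⁻¹] (res1 a '' (Set.univ : Set (Fin r → ℂ[X]))) = ⊤ := by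
  rw [eq_top_iff, ← (Pi.basisFun ℂ[T;T⁻¹] (Fin r)).span_eq, Submodule.span_le]
  rintro _ ⟨i, rfl⟩
  have h : (Pi.basisFun ℂ[T;T⁻¹] (Fin r)) i =
      (T (-a i) : ℂ[T;T⁻¹]) • res1 a (Pi.single i 1) := by
    ext1 j
    by_cases h : j = i
    · subst h
      simp only [res1, Pi.basisFun_apply, Pi.single_eq_same, Pi.smul_apply, smul_eq_mul, map_one,
        mul_one]
      rw [← T_add, neg_add_cancel, T_zero]
    · simp [res1, h]
  rw [h]
  exact Submodule.smul_mem _ _ (Submodule.subset_span ⟨_, trivial, rfl⟩)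

namespace Subsheaf

variable {r : ℕ} {a : Fin r → ℤ}

/-- The zero subsheaf. -/
instance : Bot (Subsheaf a) where
  bot := ⟨⊥, ⊥, by
    have h0 : (res0 (0 : Fin r → ℂ[X])) = 0 := by ext1 i; simp [res0]
    have h1 : (res1 a (0 : Fin r → ℂ[X])) = 0 := by ext1 i; simp [res1]
    simp [h0, h1]⟩

/-- The whole bundle, as a subsheaf of itself. -/
instance : Top (Subsheaf a) where
  top := ⟨⊤, ⊤, by
    rw [Submodule.top_coe, span_res0_top, span_res1_top]⟩

/-- The subsheaf `F(n) = F ⊗ 𝒪(n)` of `E(n)`. In the trivializations of `𝒪(n)` on `U₀` and `U₁`,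
its sections are those of `F`. -/
def twist (F : Subsheaf a) (n : ℤ) : Subsheaf (twistType a n) where
  sec0 := F.sec0
  sec1 := F.sec1
  glue := by
    rw [F.glue]
    apply le_antisymm
    · rw [Submodule.span_le]
      rintro _ ⟨v, hv, rfl⟩
      have h : res1 a v = (T (-n) : ℂ[T;T⁻¹]) • res1 (twistType a n) v := by
        rw [res1_eq_smul, smul_smul, ← T_add]; simp
      rw [h]
      exact Submodule.smul_mem _ _ (Submodule.subset_span ⟨v, hv, rfl⟩)
    · rw [Submodule.span_le]
      rintro _ ⟨v, hv, rfl⟩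
      rw [res1_eq_smul]
      exact Submodule.smul_mem _ _ (Submodule.subset_span ⟨v, hv, rfl⟩)

/-- `F` is a subbundle of `E`: the quotient sheaf `E / F` is locally free. -/
def IsSubbundle (F : Subsheaf a) : Prop :=
  Module.Projective ℂ[X] ((Fin r → ℂ[X]) ⧸ F.sec0) ∧
    Module.Projective ℂ[X] ((Fin r → ℂ[X]) ⧸ F.sec1)

/-- `Φ(F) ⊆ F(n)`, for `Φ : E → E(n)`. -/
def IsInvariant {n : ℤ} (Φ : Hom a (twistType a n)) (F : Subsheaf a) : Prop :=
  F.sec0.map (Hom.on0 Φ) ≤ (F.twist n).sec0 ∧ F.sec1.map (Hom.on1 Φ) ≤ (F.twist n).sec1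

/-- The rank of `F`. -/
def rank (F : Subsheaf a) : ℕ := Module.finrank ℂ[X] F.sec0

/-- `d` is the degree of `F`, i.e. the degree of the line bundle `det F`: for bases of `F` over
`U₀` and `U₁`, the determinant of the transition matrix over `U₀₁` is a nonzero constant times
`z ^ d`. -/
def HasDegree (F : Subsheaf a) (d : ℤ) : Prop :=
  ∃ (s : ℕ) (b0 : Module.Basis (Fin s) ℂ[X] F.sec0) (b1 : Module.Basis (Fin s) ℂ[X] F.sec1)
    (P : Matrix (Fin s) (Fin s) ℂ[T;T⁻¹]) (c : ℂ),
    (∀ j, res1 a (b1 j : Fin r → ℂ[X]) = ∑ i, P i j • res0 (b0 i : Fin r → ℂ[X])) ∧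
    c ≠ 0 ∧ P.det = LaurentPolynomial.C c * T d

/-! The degree is well defined. -/

lemma linearIndependent_res0 {s : ℕ} {v : Fin s → Fin r → ℂ[X]}
    (hv : LinearIndependent ℂ[X] v) : LinearIndependent ℂ[T;T⁻¹] (fun i => res0 (v i)) := by
  rw [Fintype.linearIndependent_iff] at hv ⊢
  intro g hg
  choose n f hf using fun i => LaurentPolynomial.exists_T_pow (g i)
  let N : ℕ := ∑ i, n i
  have hN : ∀ i, n i ≤ N := fun i =>
    Finset.single_le_sum (f := n) (fun _ _ => Nat.zero_le _) (Finset.mem_univ i)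
  let F : Fin s → ℂ[X] := fun i => f i * X ^ (N - n i)
  have hF : ∀ i, toLaurent (F i) = g i * T (N : ℤ) := by
    intro i
    simp only [F, map_mul, hf, toLaurent_X_pow, mul_T_assoc]
    congr 2
    have := hN i
    push_cast [this]
    ring
  have h0 : ∑ i, F i • v i = 0 := by
    ext1 k
    apply Polynomial.toLaurent_injective
    have hk := congrFun hg k
    simp only [Finset.sum_apply, Pi.smul_apply, smul_eq_mul, map_sum, map_mul, Pi.zero_apply,
      map_zero, hF] at hk ⊢
    calc ∑ i, g i * T (N : ℤ) * toLaurent (v i k)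
        = T (N : ℤ) * ∑ i, g i * res0 (v i) k := by
          rw [Finset.mul_sum]
          refine Finset.sum_congr rfl fun i _ => ?_
          simp only [res0, fun0]
          ring
      _ = 0 := by rw [hk, mul_zero]
  intro i
  have h1 := hF i
  rw [hv F h0 i, map_zero] at h1
  exact ((isUnit_T (R := ℂ) (N : ℤ)).mul_left_eq_zero).1 h1.symm

lemma linearIndependent_res1 {s : ℕ} {v : Fin s → Fin r → ℂ[X]}
    (hv : LinearIndependent ℂ[X] v) : LinearIndependent ℂ[T;T⁻¹] (fun i => res1 a (v i)) := by
  have h := linearIndependent_res0 hv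
  rw [Fintype.linearIndependent_iff] at h ⊢
  intro g hg i
  have h0 : ∑ i, invert (g i) • res0 (v i) = 0 := by
    ext1 k
    have hk := congrFun hg k
    simp only [Finset.sum_apply, Pi.smul_apply, smul_eq_mul, Pi.zero_apply] at hk ⊢
    have h2 : T (a k) * ∑ i, g i * fun1 (v i k) = 0 := by
      rw [← hk, Finset.mul_sum]
      refine Finset.sum_congr rfl fun i _ => ?_
      simp only [res1]
      ring
    have h3 := ((isUnit_T (R := ℂ) (a k)).mul_right_eq_zero).1 h2
    have h4 := congrArg (invert (R := ℂ)) h3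
    rw [map_sum, map_zero] at h4
    rw [← h4]
    refine Finset.sum_congr rfl fun i _ => ?_
    rw [map_mul]
    congr 1
    exact (involutive_invert (R := ℂ) _).symm
  have h5 := h _ h0 i
  exact (map_eq_zero_iff _ (invert (R := ℂ)).injective).1 h5

lemma res0_sum {s : ℕ} (c : Fin s → ℂ[X]) (v : Fin s → Fin r → ℂ[X]) :
    res0 (∑ i, c i • v i) = ∑ i, fun0 (c i) • res0 (v i) := by
  ext1 k
  simp [res0]

lemma res1_sum {s : ℕ} (c : Fin s → ℂ[X]) (v : Fin s → Fin r → ℂ[X]) :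
    res1 a (∑ i, c i • v i) = ∑ i, fun1 (c i) • res1 a (v i) := by
  ext1 k
  simp only [res1, Finset.sum_apply, Pi.smul_apply, smul_eq_mul, map_sum, map_mul, Finset.mul_sum]
  exact Finset.sum_congr rfl fun i _ => by ring

lemma coe_eq_sum {M : Submodule ℂ[X] (Fin r → ℂ[X])} {s : ℕ} (b : Module.Basis (Fin s) ℂ[X] M)
    (x : M) : (x : Fin r → ℂ[X]) = ∑ i, b.repr x i • (b i : Fin r → ℂ[X]) := by
  have h := congrArg M.subtype (b.sum_repr x)
  rw [map_sum] at h
  exact h.symm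

lemma span_res0_basis {M : Submodule ℂ[X] (Fin r → ℂ[X])} {s : ℕ}
    (b : Module.Basis (Fin s) ℂ[X] M) :
    Submodule.span ℂ[T;T⁻¹] (Set.range fun i => res0 (b i : Fin r → ℂ[X])) =
      Submodule.span ℂ[T;T⁻¹] (res0 '' (M : Set (Fin r → ℂ[X]))) := by
  apply le_antisymm <;> rw [Submodule.span_le]
  · rintro _ ⟨i, rfl⟩
    exact Submodule.subset_span ⟨_, (b i).2, rfl⟩
  · rintro _ ⟨x, hx, rfl⟩
    have h := coe_eq_sum b ⟨x, hx⟩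
    rw [show x = _ from h, res0_sum]
    exact Submodule.sum_mem _ fun i _ =>
      Submodule.smul_mem _ _ (Submodule.subset_span ⟨i, rfl⟩)

lemma span_res1_basis {M : Submodule ℂ[X] (Fin r → ℂ[X])} {s : ℕ}
    (b : Module.Basis (Fin s) ℂ[X] M) :
    Submodule.span ℂ[T;T⁻¹] (Set.range fun i => res1 a (b i : Fin r → ℂ[X])) =
      Submodule.span ℂ[T;T⁻¹] (res1 a '' (M : Set (Fin r → ℂ[X]))) := by
  apply le_antisymm <;> rw [Submodule.span_le]
  · rintro _ ⟨i, rfl⟩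
    exact Submodule.subset_span ⟨_, (b i).2, rfl⟩
  · rintro _ ⟨x, hx, rfl⟩
    have h := coe_eq_sum b ⟨x, hx⟩
    rw [show x = _ from h, res1_sum]
    exact Submodule.sum_mem _ fun i _ =>
      Submodule.smul_mem _ _ (Submodule.subset_span ⟨i, rfl⟩)

lemma linearIndependent_coe {M : Submodule ℂ[X] (Fin r → ℂ[X])} {s : ℕ}
    (b : Module.Basis (Fin s) ℂ[X] M) :
    LinearIndependent ℂ[X] (fun i => (b i : Fin r → ℂ[X])) :=
  b.linearIndependent.map' M.subtype M.ker_subtype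

lemma isUnit_laurent {u : ℂ[T;T⁻¹]} (hu : IsUnit u) :
    ∃ (c : ℂ) (d : ℤ), c ≠ 0 ∧ u = LaurentPolynomial.C c * T d := by
  obtain ⟨v, hv⟩ := hu.exists_right_inv
  obtain ⟨n, f, hf⟩ := LaurentPolynomial.exists_T_pow u
  obtain ⟨m, g, hg⟩ := LaurentPolynomial.exists_T_pow v
  have hfg : f * g = X ^ (n + m) := by
    apply Polynomial.toLaurent_injective
    rw [map_mul, hf, hg, toLaurent_X_pow]
    calc u * T (n : ℤ) * (v * T (m : ℤ)) = (u * v) * (T (n : ℤ) * T (m : ℤ)) := by ring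
      _ = T ((n + m : ℕ) : ℤ) := by rw [hv, one_mul, ← T_add]; push_cast; rfl
  obtain ⟨k, -, hk⟩ := (dvd_prime_pow (Polynomial.prime_X (R := ℂ)) _).1 (Dvd.intro _ hfg)
  obtain ⟨w, hw⟩ := hk.symm
  obtain ⟨c, hc, hcw⟩ := Polynomial.isUnit_iff.1 w.isUnit
  refine ⟨c, (k : ℤ) - n, hc.ne_zero, ?_⟩
  have h1 : u * T (n : ℤ) = LaurentPolynomial.C c * T (k : ℤ) := by
    rw [← hf, ← hw, ← hcw, map_mul, toLaurent_X_pow, toLaurent_C, mul_comm]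
  calc u = u * T (n : ℤ) * T (-(n : ℤ)) := by rw [mul_T_assoc]; simp
    _ = _ := by rw [h1, mul_T_assoc, sub_eq_add_neg]

lemma exists_hasDegree (F : Subsheaf a) : ∃ d, F.HasDegree d := by
  obtain ⟨s, b0⟩ := Submodule.basisOfPid (Pi.basisFun ℂ[X] (Fin r)) F.sec0
  obtain ⟨t, b1⟩ := Submodule.basisOfPid (Pi.basisFun ℂ[X] (Fin r)) F.sec1
  have l0 := linearIndependent_res0 (linearIndependent_coe b0)
  have l1 := linearIndependent_res1 (a := a) (linearIndependent_coe b1)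
  have hspan : Submodule.span ℂ[T;T⁻¹] (Set.range fun i => res1 a (b1 i : Fin r → ℂ[X])) =
      Submodule.span ℂ[T;T⁻¹] (Set.range fun i => res0 (b0 i : Fin r → ℂ[X])) := by
    rw [span_res0_basis, span_res1_basis, F.glue]
  let c0 := Module.Basis.span l0
  let c1 := (Module.Basis.span l1).map (LinearEquiv.ofEq _ _ hspan)
  have hst : s = t := by simpa using Fintype.card_congr (c0.indexEquiv c1)
  subst hst
  have hu : IsUnit (c0.toMatrix c1).det := by
    rw [← Module.Basis.det_apply]
    exact c0.isUnit_det c1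
  obtain ⟨c, d, hc, hd⟩ := isUnit_laurent hu
  refine ⟨d, s, b0, b1, c0.toMatrix c1, c, fun j => ?_, hc, hd⟩
  have h := congrArg (Submodule.subtype _) (c0.sum_toMatrix_smul_self (v := c1) j)
  rw [map_sum] at h
  have h1 : (c1 j : Fin r → ℂ[T;T⁻¹]) = res1 a (b1 j : Fin r → ℂ[X]) := by
    simp [c1, Module.Basis.span_apply]
  have h0 : ∀ i, (c0 i : Fin r → ℂ[T;T⁻¹]) = res0 (b0 i : Fin r → ℂ[X]) := fun i => by
    simp [c0, Module.Basis.span_apply]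
  rw [← h1]
  refine h.symm.trans (Finset.sum_congr rfl fun i _ => ?_)
  rw [map_smul, Submodule.subtype_apply, h0]

lemma exists_det_fun {s : ℕ} {M : Submodule ℂ[X] (Fin r → ℂ[X])}
    (b b' : Module.Basis (Fin s) ℂ[X] M) :
    ∃ c : ℂ, c ≠ 0 ∧ (b.toMatrix b').det = Polynomial.C c := by
  have hu : IsUnit (b.toMatrix b').det := by
    rw [← Module.Basis.det_apply]
    exact b.isUnit_det b'
  obtain ⟨c, hc, h⟩ := Polynomial.isUnit_iff.1 hu
  exact ⟨c, hc.ne_zero, h.symm⟩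

lemma HasDegree.unique {F : Subsheaf a} {d d' : ℤ} (h : F.HasDegree d) (h' : F.HasDegree d') :
    d = d' := by
  obtain ⟨s, b0, b1, P, c, hP, hc, hd⟩ := h
  obtain ⟨s', b0', b1', P', c', hP', hc', hd'⟩ := h'
  have hs : s = s' := by simpa using Fintype.card_congr (b0.indexEquiv b0')
  subst hs
  obtain ⟨u0, hu0, e0⟩ := exists_det_fun b0 b0'
  obtain ⟨u1, hu1, e1⟩ := exists_det_fun b1 b1'
  have key : (b0.toMatrix b0').map fun0 * P' = P * (b1.toMatrix b1').map fun1 := by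
    have l0 := linearIndependent_res0 (linearIndependent_coe b0)
    ext1 k j
    have hA : res1 a (b1' j : Fin r → ℂ[X]) =
        ∑ k, ((b0.toMatrix b0').map fun0 * P') k j • res0 (b0 k : Fin r → ℂ[X]) := by
      rw [hP' j]
      simp_rw [Matrix.mul_apply, Finset.sum_smul]
      rw [Finset.sum_comm]
      refine Finset.sum_congr rfl fun i _ => ?_
      rw [coe_eq_sum b0 (b0' i), res0_sum, Finset.smul_sum]
      refine Finset.sum_congr rfl fun k _ => ?_
      rw [smul_smul, mul_comm]
      rfl
    have hB : res1 a (b1' j : Fin r → ℂ[X]) =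
        ∑ k, (P * (b1.toMatrix b1').map fun1) k j • res0 (b0 k : Fin r → ℂ[X]) := by
      rw [coe_eq_sum b1 (b1' j), res1_sum]
      simp_rw [Matrix.mul_apply, Finset.sum_smul]
      rw [Finset.sum_comm]
      refine Finset.sum_congr rfl fun i _ => ?_
      rw [hP i, Finset.smul_sum]
      refine Finset.sum_congr rfl fun k _ => ?_
      rw [smul_smul, mul_comm]
      rfl
    have hAB := hA.symm.trans hB
    rw [← sub_eq_zero, ← Finset.sum_sub_distrib] at hAB
    simp_rw [← sub_smul] at hAB
    exact sub_eq_zero.1 (Fintype.linearIndependent_iff.1 l0 _ hAB k)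
  have hdet := congrArg Matrix.det key
  rw [Matrix.det_mul, Matrix.det_mul] at hdet
  have f0 : ((b0.toMatrix b0').map fun0).det = LaurentPolynomial.C u0 := by
    rw [← RingHom.mapMatrix_apply, ← RingHom.map_det, e0]
    simp [fun0]
  have f1 : ((b1.toMatrix b1').map fun1).det = LaurentPolynomial.C u1 := by
    rw [← RingHom.mapMatrix_apply, ← RingHom.map_det, e1]
    simp [fun1]
  rw [f0, f1, hd, hd'] at hdet
  have h2 : LaurentPolynomial.C (u0 * c') * T d' = LaurentPolynomial.C (u1 * c) * T d := by
    rw [map_mul, map_mul, mul_assoc, hdet]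
    ring
  have h3 := congrArg LaurentPolynomial.degree h2
  rw [degree_C_mul_T _ _ (mul_ne_zero hu0 hc'), degree_C_mul_T _ _ (mul_ne_zero hu1 hc)] at h3
  exact (WithBot.coe_injective h3).symm

/-- The degree of `F`. -/
def degree (F : Subsheaf a) : ℤ := F.exists_hasDegree.choose

lemma hasDegree_degree (F : Subsheaf a) : F.HasDegree F.degree := F.exists_hasDegree.choose_spec

/-- The slope `μ(F) = deg F / rank F` (of a nonzero subsheaf). -/
def slope (F : Subsheaf a) : ℚ := (F.degree : ℚ) / (F.rank : ℚ)

end Subsheaf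

/-- The pair `(E, Φ)`, where `E = ⨁ᵢ 𝒪(aᵢ)` and `Φ : E → E(n)`, is semistable. -/
def IsSemistable {r : ℕ} {a : Fin r → ℤ} {n : ℤ} (Φ : Hom a (twistType a n)) : Prop :=
  ∀ F : Subsheaf a, F ≠ ⊥ → F ≠ ⊤ → F.IsInvariant Φ → F.slope ≤ (⊤ : Subsheaf a).slope

/-- The pair `(E, Φ)`, where `E = ⨁ᵢ 𝒪(aᵢ)` and `Φ : E → E(n)`, is stable. -/
def IsStable {r : ℕ} {a : Fin r → ℤ} {n : ℤ} (Φ : Hom a (twistType a n)) : Prop :=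
  ∀ F : Subsheaf a, F ≠ ⊥ → F ≠ ⊤ → F.IsInvariant Φ → F.slope < (⊤ : Subsheaf a).slope

/-- No proper nonzero subbundle `F` of `E` satisfies `Φ(F) ⊆ F(n)`. -/
def HasNoInvariantSubbundle {r : ℕ} {a : Fin r → ℤ} {n : ℤ} (Φ : Hom a (twistType a n)) : Prop :=
  ∀ F : Subsheaf a, F.IsSubbundle → F ≠ ⊥ → F ≠ ⊤ → ¬ F.IsInvariant Φ

/-- The companion-type matrix of the map `e₁ ↦ e₂ ↦ ⋯ ↦ e_r ↦ z e₁` (columns are the images of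
the basis vectors). -/
def companion (r : ℕ) : Matrix (Fin r) (Fin r) ℂ[X] :=
  Matrix.of fun i j =>
    if (i : ℕ) = j + 1 then 1 else if (i : ℕ) = 0 ∧ (j : ℕ) + 1 = r then X else 0

/-- Polynomial functions on a complex vector space: the algebra of functions generated by the
linear forms. -/
def polyFun (V : Type*) [AddCommGroup V] [Module ℂ V] : Subalgebra ℂ (V → ℂ) :=
  Algebra.adjoin ℂ (Set.range fun l : Module.Dual ℂ V => (l : V → ℂ))

/-- Zariski open subsets of a (finite-dimensional) complex vector space: complements of the set of
common zeros of a family of polynomial functions. -/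
def IsZariskiOpen {V : Type*} [AddCommGroup V] [Module ℂ V] (U : Set V) : Prop :=
  ∃ S : Set (V → ℂ), S ⊆ (polyFun V : Set (V → ℂ)) ∧ Uᶜ = {v | ∀ f ∈ S, f v = 0}

end P1

end

/-!
An invariant subbundle is determined by its fibre at the generic point, an invariant subspace over
the field `ℂ(z)`, and every such subspace is the generic fibre of an invariant subbundle. Hence `Φ`
has no invariant proper subbundle if and only if the characteristic polynomial of its matrix is
irreducible over `ℂ(z)`, which by Gauss's lemma means irreducible in `ℂ[z][t]`.

If this is so, then an invariant subsheaf `0 ≠ F ≠ E` has full rank. The determinant of its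
inclusion into `E` is a nonzero section of `𝒪(deg E - deg F)`, and is not invertible as `F ≠ E`;
hence `deg F < deg E`, which gives stability. If on the other hand `a i - a (i + 1)` is larger than
the twist, then the `𝒪(a j)` with `j ≤ i` span a direct summand of `E` that is invariant under every
`Φ` for degree reasons, and it destabilizes because its summands have larger degree than the others.

For the companion matrix the characteristic polynomial is `t ^ r - z`, an Eisenstein polynomial.

For openness, suppose that every polynomial function vanishing at all `Φ` in a set `Z` vanishes
at `Φ₀`, and that the characteristic polynomial is reducible at all points of `Z`. As there are
finitely many possible degrees of a factor and the vanishing ideal of `Φ₀` is prime, we may assume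
that all points of `Z` have a monic factor of the same degree. These factors assemble to one
over the ring of all functions on `Z`, whose coefficients are integral over the polynomial functions
as those of a monic factor of a monic polynomial. By lying over, evaluation at `Φ₀` extends to the
integral closure, and so the factorization specializes to `Φ₀`.
-/

noncomputable section

namespace P1

section Charpoly

variable {K V : Type*} [Field K] [AddCommGroup V] [Module K V]

lemma dvd_of_aeval_apply_eq_zero {φ : Module.End K V} {p q : K[X]} (hq : Irreducible q) {v : V}
    (hv : v ≠ 0) (hqv : aeval φ q v = 0) (hpv : aeval φ p v = 0) : q ∣ p := by
  by_contra hdvd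
  obtain ⟨s, t, hst⟩ := hq.coprime_iff_not_dvd.2 hdvd
  apply hv
  calc v = aeval φ (s * q + t * p) v := by simp [hst]
    _ = 0 := by simp [hqv, hpv]

lemma finrank_degreeLT (n : ℕ) : Module.finrank K (degreeLT K n) = n := by
  rw [(degreeLTEquiv K n).finrank_eq, Module.finrank_fin_fun]

instance (n : ℕ) : FiniteDimensional K (degreeLT K n) :=
  Module.Finite.equiv (degreeLTEquiv K n).symm

/-- The `K[X]`-orbit map `p ↦ p(φ) v` of a vector `v`, whose range is the cyclic subspace that `v`
generates. -/
def orbitMap (φ : Module.End K V) (v : V) : K[X] →ₗ[K] V :=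
  LinearMap.applyₗ v ∘ₗ (aeval φ).toLinearMap

@[simp]
lemma orbitMap_apply (φ : Module.End K V) (v : V) (p : K[X]) : orbitMap φ v p = aeval φ p v := rfl

lemma range_orbitMap_mem_invtSubmodule (φ : Module.End K V) (v : V) :
    LinearMap.range (orbitMap φ v) ∈ φ.invtSubmodule := by
  rintro _ ⟨p, rfl⟩
  exact ⟨X * p, by simp⟩

lemma finrank_range_orbitMap_le {φ : Module.End K V} {v : V} {h : K[X]} (hm : h.Monic)
    (hv : aeval φ h v = 0) :
    Module.finrank K (LinearMap.range (orbitMap φ v)) ≤ h.natDegree := by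
  have hrange : LinearMap.range (orbitMap φ v) ≤ (degreeLT K h.natDegree).map (orbitMap φ v) := by
    rintro _ ⟨p, rfl⟩
    refine ⟨p %ₘ h, ?_, ?_⟩
    · rw [SetLike.mem_coe, mem_degreeLT, ← degree_eq_natDegree hm.ne_zero]
      exact degree_modByMonic_lt p hm
    · conv_rhs => rw [← modByMonic_add_div p h]
      simp [mul_comm h, hv]
  exact (Submodule.finrank_mono hrange).trans
    ((Submodule.finrank_map_le _ _).trans (finrank_degreeLT _).le)

variable [FiniteDimensional K V]

lemma eq_top_of_irreducible_charpoly {φ : Module.End K V} (hφ : Irreducible φ.charpoly)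
    {W : Submodule K V} (hW : W ∈ φ.invtSubmodule) (hbot : W ≠ ⊥) : W = ⊤ := by
  obtain ⟨v, hvW, hv⟩ := W.exists_mem_ne_zero_of_ne_bot hbot
  set e := (orbitMap φ v).domRestrict (degreeLT K (Module.finrank K V))
  have he : Function.Injective e := by
    refine (injective_iff_map_eq_zero e).2 fun ⟨p, hp⟩ hpv => Subtype.ext ?_
    have hdvd := dvd_of_aeval_apply_eq_zero hφ hv (by simp [LinearMap.aeval_self_charpoly]) hpv
    refine eq_zero_of_dvd_of_degree_lt hdvd ((mem_degreeLT.1 hp).trans_eq ?_)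
    rw [degree_eq_natDegree φ.charpoly_monic.ne_zero, φ.charpoly_natDegree]
  have heW : LinearMap.range e ≤ W := by
    rintro _ ⟨p, rfl⟩
    exact aeval_apply_smul_mem_of_le_comap hvW p.1 φ hW
  refine W.eq_top_of_finrank_eq (W.finrank_le.antisymm ?_)
  calc Module.finrank K V = Module.finrank K (LinearMap.range e) := by
        rw [LinearMap.finrank_range_of_inj he, finrank_degreeLT]
    _ ≤ Module.finrank K W := Submodule.finrank_mono heW

lemma irreducible_charpoly_iff [Nontrivial V] (φ : Module.End K V) :
    Irreducible φ.charpoly ↔ ∀ W ∈ φ.invtSubmodule, W ≠ ⊥ → W = ⊤ := by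
  refine ⟨fun h W hW => eq_top_of_irreducible_charpoly h hW, fun H => ?_⟩
  have le_natDegree : ∀ {h : K[X]} {v : V}, h.Monic → v ≠ 0 → aeval φ h v = 0 →
      Module.finrank K V ≤ h.natDegree := fun {h v} hm hv hhv => by
    have htop := H _ (range_orbitMap_mem_invtSubmodule φ v)
      ((Submodule.ne_bot_iff _).2 ⟨v, ⟨1, by simp⟩, hv⟩)
    have hle := finrank_range_orbitMap_le hm hhv
    rwa [htop, finrank_top] at hle
  have hpos : 0 < Module.finrank K V := Module.finrank_pos
  refine φ.charpoly_monic.irreducible_iff_natDegree.2 ⟨fun h1 => ?_, fun f g hf hg hfg => ?_⟩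
  · simp [← φ.charpoly_natDegree, h1] at hpos
  have hdeg : f.natDegree + g.natDegree = Module.finrank K V := by
    rw [← hf.natDegree_mul hg, hfg, φ.charpoly_natDegree]
  obtain ⟨v, hv⟩ := exists_ne (0 : V)
  by_cases hgv : aeval φ g v = 0
  · have := le_natDegree hg hv hgv
    omega
  · have hfgv : aeval φ f (aeval φ g v) = 0 := by
      rw [← Module.End.mul_apply, ← map_mul, hfg, φ.aeval_self_charpoly, LinearMap.zero_apply]
    have := le_natDegree hf hgv hfgv
    omega

end Charpoly

section FractionField

variable {R : Type*} [CommRing R] [IsDomain R]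

lemma finrank_span_range (K : Type*) [Field K] [Algebra R K] [IsFractionRing R K] {M V : Type*}
    [AddCommGroup M] [Module R M] [Module.Free R M] [Module.Finite R M] [AddCommGroup V]
    [Module R V] [Module K V] [IsScalarTower R K V] {f : M →ₗ[R] V} (hf : Function.Injective f) :
    Module.finrank K (Submodule.span K (Set.range f)) = Module.finrank R M := by
  let b := Module.finBasis R M
  have hspan : Submodule.span K (Set.range f) = Submodule.span K (Set.range (f ∘ b)) := by
    refine le_antisymm (Submodule.span_le.2 ?_)
      (Submodule.span_mono (Set.range_comp_subset_range b f))
    rintro _ ⟨v, rfl⟩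
    rw [← b.sum_repr v, map_sum]
    refine sum_mem fun i _ => ?_
    rw [map_smul, ← algebraMap_smul K]
    exact Submodule.smul_mem _ _ (Submodule.subset_span ⟨i, rfl⟩)
  have hli : LinearIndependent K (f ∘ b) :=
    (LinearIndependent.iff_fractionRing R K).1
      (b.linearIndependent.map' f (LinearMap.ker_eq_bot.2 hf))
  rw [hspan, finrank_span_eq_card hli, Fintype.card_fin]

lemma projective_quotient [IsPrincipalIdealRing R] {M : Type*} [AddCommGroup M] [Module R M]
    [Module.Finite R M] {N : Submodule R M} (h : ∀ c : R, c ≠ 0 → ∀ v, c • v ∈ N → v ∈ N) :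
    Module.Projective R (M ⧸ N) := by
  have : Module.IsTorsionFree R (M ⧸ N) := by
    refine Module.IsTorsionFree.of_smul_eq_zero fun c x hx => or_iff_not_imp_left.2 fun hc => ?_
    obtain ⟨v, rfl⟩ := N.mkQ_surjective x
    rw [Submodule.mkQ_apply, Submodule.Quotient.mk_eq_zero]
    rw [← map_smul, Submodule.mkQ_apply, Submodule.Quotient.mk_eq_zero] at hx
    exact h c hc v hx
  infer_instance

lemma eq_top_of_finrank_eq {M : Type*} [AddCommGroup M] [Module R M] [Module.Finite R M]
    {N : Submodule R M} [Module.Projective R (M ⧸ N)]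
    (h : Module.finrank R N = Module.finrank R M) : N = ⊤ := by
  have hQ : Module.finrank R (M ⧸ N) = 0 := by
    have := N.finrank_quotient_add_finrank
    omega
  have : Module.IsTorsionFree R (M ⧸ N) := inferInstance
  exact Submodule.Quotient.subsingleton_iff.1 (Module.finrank_zero_iff.1 hQ)

end FractionField

section Restriction

/-- The coordinatewise application of a ring homomorphism to vectors, as a semilinear map. -/
def mapVec {R S : Type*} [Semiring R] [Semiring S] (σ : R →+* S) (ι : Type*) :
    (ι → R) →ₛₗ[σ] (ι → S) where
  toFun v i := σ (v i)
  map_add' v w := by ext i; simp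
  map_smul' c v := by ext i; simp

@[simp]
lemma mapVec_apply {R S : Type*} [Semiring R] [Semiring S] (σ : R →+* S) {ι : Type*} (v : ι → R)
    (i : ι) : mapVec σ ι v i = σ (v i) := rfl

lemma mapVec_single_one {R S : Type*} [Semiring R] [Semiring S] (σ : R →+* S) {ι : Type*}
    [DecidableEq ι] (i : ι) : mapVec σ ι (Pi.single i 1) = Pi.single i 1 := by
  ext j
  simp [Pi.single_apply, apply_ite σ]

lemma mapVec_apply_linearMap {R S : Type*} [CommRing R] [CommRing S] (σ : R →+* S) {ι κ : Type*}
    [Fintype ι] [DecidableEq ι] (φ : (ι → R) →ₗ[R] (κ → R)) (v : ι → R) :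
    mapVec σ κ (φ v) = Matrix.mulVec ((LinearMap.toMatrix' φ).map σ) (mapVec σ ι v) := by
  ext i
  rw [mapVec_apply, ← LinearMap.toMatrix'_mulVec, RingHom.map_mulVec]
  rfl

variable {r : ℕ}

lemma fun0_injective : Function.Injective fun0 := Polynomial.toLaurent_injective

lemma fun1_injective : Function.Injective fun1 :=
  (invert (R := ℂ)).injective.comp Polynomial.toLaurent_injective

lemma fun0_X_pow (k : ℕ) : fun0 (X ^ k) = T k := toLaurent_X_pow k

lemma fun1_X_pow (k : ℕ) : fun1 (X ^ k) = T (-k) := by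
  rw [fun1, RingHom.comp_apply, toLaurent_X_pow]
  exact invert_T _

/-- The restriction of sections from `U₀` to `U₀₁`, as a semilinear map. -/
def res0Hom (r : ℕ) : (Fin r → ℂ[X]) →ₛₗ[fun0] (Fin r → ℂ[T;T⁻¹]) := mapVec fun0 (Fin r)

/-- The restriction of sections of `⨁ᵢ 𝒪(aᵢ)` from `U₁` to `U₀₁`, as a semilinear map. -/
def res1Hom (a : Fin r → ℤ) : (Fin r → ℂ[X]) →ₛₗ[fun1] (Fin r → ℂ[T;T⁻¹]) where
  toFun := res1 a
  map_add' v w := by ext1 i; simp [res1, mul_add]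
  map_smul' c v := by
    ext1 i
    simp only [res1, Pi.smul_apply, smul_eq_mul, map_mul]
    ring

lemma res0Hom_apply (v : Fin r → ℂ[X]) : res0Hom r v = res0 v := rfl

lemma res1Hom_apply (a : Fin r → ℤ) (v : Fin r → ℂ[X]) : res1Hom a v = res1 a v := rfl

lemma exists_T_smul_eq_res0 (x : Fin r → ℂ[T;T⁻¹]) :
    ∃ (n : ℤ) (v : Fin r → ℂ[X]), (T n : ℂ[T;T⁻¹]) • x = res0 v := by
  choose n f hf using fun i => LaurentPolynomial.exists_T_pow (x i)
  refine ⟨∑ i, n i, fun i => X ^ ((∑ i, n i) - n i) * f i, ?_⟩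
  ext1 i
  have hi : n i ≤ ∑ i, n i := Finset.single_le_sum (by simp) (Finset.mem_univ i)
  rw [res0, fun0, map_mul, hf, toLaurent_X_pow, mul_left_comm, ← T_add, Pi.smul_apply, smul_eq_mul,
    mul_comm, ← Nat.cast_add, Nat.sub_add_cancel hi, Nat.cast_sum]

lemma exists_T_smul_eq_res1 (a : Fin r → ℤ) (x : Fin r → ℂ[T;T⁻¹]) :
    ∃ (n : ℤ) (v : Fin r → ℂ[X]), (T n : ℂ[T;T⁻¹]) • x = res1 a v := by
  obtain ⟨n, v, h⟩ := exists_T_smul_eq_res0 fun i => invert (T (-a i) * x i)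
  refine ⟨-n, v, ?_⟩
  ext1 i
  have hi : T (-n) * (T (-a i) * x i) = fun1 (v i) := by
    have := congrArg (invert (R := ℂ)) (congrFun h i)
    rwa [Pi.smul_apply, smul_eq_mul, map_mul, invert_T, involutive_invert] at this
  rw [res1, ← hi, mul_left_comm, ← mul_assoc (T (a i)), ← T_add, add_neg_cancel, T_zero, one_mul,
    Pi.smul_apply, smul_eq_mul]

lemma span_image_comap_eq {L : Submodule ℂ[T;T⁻¹] (Fin r → ℂ[T;T⁻¹])} {σ : ℂ[X] →+* ℂ[T;T⁻¹]}
    (f : (Fin r → ℂ[X]) →ₛₗ[σ] (Fin r → ℂ[T;T⁻¹]))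
    (hf : ∀ x, ∃ (n : ℤ) (v : Fin r → ℂ[X]), (T n : ℂ[T;T⁻¹]) • x = f v) :
    Submodule.span ℂ[T;T⁻¹] (f '' (L.comap f)) = L := by
  refine le_antisymm (Submodule.span_le.2 (Set.image_preimage_subset f L)) fun x hx => ?_
  obtain ⟨n, v, hv⟩ := hf x
  have hvL : v ∈ L.comap f := by
    rw [Submodule.mem_comap, ← hv]
    exact L.smul_mem _ hx
  have hxv : x = (T (-n) : ℂ[T;T⁻¹]) • f v := by
    rw [← hv, smul_smul, ← T_add, neg_add_cancel, T_zero, one_smul]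
  rw [hxv]
  exact Submodule.smul_mem _ _ (Submodule.subset_span ⟨v, hvL, rfl⟩)

end Restriction

namespace Subsheaf

variable {r : ℕ} {a : Fin r → ℤ}

/-- The largest subsheaf whose sections over `U₀₁` form the module `L`. -/
def ofOverlap (a : Fin r → ℤ) (L : Submodule ℂ[T;T⁻¹] (Fin r → ℂ[T;T⁻¹])) : Subsheaf a where
  sec0 := L.comap (res0Hom r)
  sec1 := L.comap (res1Hom a)
  glue := (span_image_comap_eq (res0Hom r) exists_T_smul_eq_res0).trans
    (span_image_comap_eq (res1Hom a) (exists_T_smul_eq_res1 a)).symm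

lemma mem_ofOverlap_sec0 {L : Submodule ℂ[T;T⁻¹] (Fin r → ℂ[T;T⁻¹])} {v : Fin r → ℂ[X]} :
    v ∈ (ofOverlap a L).sec0 ↔ res0 v ∈ L := Iff.rfl

lemma mem_ofOverlap_sec1 {L : Submodule ℂ[T;T⁻¹] (Fin r → ℂ[T;T⁻¹])} {v : Fin r → ℂ[X]} :
    v ∈ (ofOverlap a L).sec1 ↔ res1 a v ∈ L := Iff.rfl

lemma isSubbundle_ofOverlap {L : Submodule ℂ[T;T⁻¹] (Fin r → ℂ[T;T⁻¹])}
    (hL : ∀ c : ℂ[T;T⁻¹], c ≠ 0 → ∀ x, c • x ∈ L → x ∈ L) : (ofOverlap a L).IsSubbundle := by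
  refine ⟨projective_quotient fun c hc v hv => ?_, projective_quotient fun c hc v hv => ?_⟩
  · rw [mem_ofOverlap_sec0, ← res0Hom_apply, map_smulₛₗ] at hv
    exact hL _ ((map_ne_zero_iff _ fun0_injective).2 hc) _ hv
  · rw [mem_ofOverlap_sec1, ← res1Hom_apply, map_smulₛₗ] at hv
    exact hL _ ((map_ne_zero_iff _ fun1_injective).2 hc) _ hv

lemma isInvariant_ofOverlap {n : ℤ} {Φ : Hom a (twistType a n)}
    {L : Submodule ℂ[T;T⁻¹] (Fin r → ℂ[T;T⁻¹])} (hL : L ≤ L.comap Φ.1.2.2) :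
    (ofOverlap a L).IsInvariant Φ := by
  refine ⟨Submodule.map_le_iff_le_comap.2 fun v hv => ?_,
    Submodule.map_le_iff_le_comap.2 fun v hv => ?_⟩
  · change res0 (Φ.1.1 v) ∈ L
    rw [← Φ.2.1]
    exact hL hv
  · change res1 a (Φ.1.2.1 v) ∈ L
    have h : (T (-n) : ℂ[T;T⁻¹]) • Φ.1.2.2 (res1 a v) = res1 a (Φ.1.2.1 v) := by
      rw [Φ.2.2, res1_eq_smul, smul_smul, ← T_add, neg_add_cancel, T_zero, one_smul]
    rw [← h]
    exact L.smul_mem _ (hL hv)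

lemma finrank_sec1 (F : Subsheaf a) : Module.finrank ℂ[X] F.sec1 = F.rank := by
  obtain ⟨s, b0, b1, -⟩ := F.hasDegree_degree
  rw [rank, Module.finrank_eq_card_basis b0, Module.finrank_eq_card_basis b1]

lemma eq_bot_of_sec0_eq_bot {F : Subsheaf a} (h : F.sec0 = ⊥) : F = ⊥ := by
  refine Subsheaf.ext h ((Submodule.finrank_eq_zero (R := ℂ[X])).1 ?_)
  rw [finrank_sec1, rank, h, finrank_bot]

lemma IsSubbundle.eq_top_of_rank_eq {F : Subsheaf a} (hF : F.IsSubbundle) (h : F.rank = r) :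
    F = ⊤ := by
  obtain ⟨hF0, hF1⟩ := hF
  refine Subsheaf.ext (eq_top_of_finrank_eq ?_) (eq_top_of_finrank_eq ?_)
  · rwa [Module.finrank_fin_fun]
  · rwa [finrank_sec1, Module.finrank_fin_fun]

end Subsheaf

section GenericFibre

/-- The function field of `ℙ¹`. -/
abbrev FunctionField : Type := FractionRing ℂ[T;T⁻¹]

lemma algebraMap_functionField (f : ℂ[X]) :
    algebraMap ℂ[X] FunctionField f = algebraMap ℂ[T;T⁻¹] FunctionField (fun0 f) :=
  IsScalarTower.algebraMap_apply ℂ[X] ℂ[T;T⁻¹] FunctionField f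

instance : FaithfulSMul ℂ[X] FunctionField :=
  (faithfulSMul_iff_algebraMap_injective _ _).2 fun f g h => by
    rw [algebraMap_functionField, algebraMap_functionField] at h
    exact fun0_injective (IsFractionRing.injective ℂ[T;T⁻¹] FunctionField h)

instance : IsFractionRing ℂ[X] FunctionField := by
  refine IsFractionRing.of_field _ _ fun z => ?_
  obtain ⟨f, g, hg, rfl⟩ := IsFractionRing.div_surjective ℂ[T;T⁻¹] z
  obtain ⟨m, p, hp⟩ := exists_T_pow f
  obtain ⟨n, q, hq⟩ := exists_T_pow g
  refine ⟨p * X ^ n, q * X ^ m, ?_⟩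
  have hT (k : ℕ) : algebraMap ℂ[T;T⁻¹] FunctionField (T k) ≠ 0 :=
    ((isUnit_T (R := ℂ) k).map _).ne_zero
  have hg' := IsFractionRing.to_map_ne_zero_of_mem_nonZeroDivisors (K := FunctionField) hg
  simp only [algebraMap_functionField, fun0, map_mul, hp, hq, toLaurent_X_pow]
  field_simp [hT]

variable {r : ℕ} {a : Fin r → ℤ} {n : ℤ}

/-- The map that `Φ : E → E(n)` induces on the fibre of `E` at the generic point. -/
def Hom.generic (Φ : Hom a (twistType a n)) : Module.End FunctionField (Fin r → FunctionField) :=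
  Matrix.toLin' ((LinearMap.toMatrix' (Hom.on0 Φ)).map (algebraMap ℂ[X] FunctionField))

lemma Hom.generic_mapVec_on0 (Φ : Hom a (twistType a n)) (v : Fin r → ℂ[X]) :
    Hom.generic Φ (mapVec (algebraMap ℂ[X] FunctionField) (Fin r) v) =
      mapVec (algebraMap ℂ[X] FunctionField) (Fin r) (Hom.on0 Φ v) := by
  rw [Hom.generic, Matrix.toLin'_apply, ← mapVec_apply_linearMap]

lemma Hom.charpoly_generic (Φ : Hom a (twistType a n)) :
    (Hom.generic Φ).charpoly =
      (LinearMap.toMatrix' (Hom.on0 Φ)).charpoly.map (algebraMap ℂ[X] FunctionField) := by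
  rw [Hom.generic, Matrix.charpoly_toLin', Matrix.charpoly_map]

lemma Hom.toMatrix'_overlap (Φ : Hom a (twistType a n)) :
    LinearMap.toMatrix' Φ.1.2.2 = (LinearMap.toMatrix' (Hom.on0 Φ)).map fun0 := by
  ext i j
  have h := congrFun (Φ.2.1 (Pi.single j 1)) i
  rw [← res0Hom_apply, res0Hom, mapVec_single_one] at h
  rw [LinearMap.toMatrix'_apply, h]
  rfl

lemma Hom.generic_mapVec_overlap (Φ : Hom a (twistType a n)) (x : Fin r → ℂ[T;T⁻¹]) :
    Hom.generic Φ (mapVec (algebraMap ℂ[T;T⁻¹] FunctionField) (Fin r) x) =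
      mapVec (algebraMap ℂ[T;T⁻¹] FunctionField) (Fin r) (Φ.1.2.2 x) := by
  have hmap : (LinearMap.toMatrix' (Hom.on0 Φ)).map (algebraMap ℂ[X] FunctionField) =
      (LinearMap.toMatrix' Φ.1.2.2).map (algebraMap ℂ[T;T⁻¹] FunctionField) := by
    rw [Hom.toMatrix'_overlap, Matrix.map_map]
    exact congrArg _ (funext algebraMap_functionField)
  rw [Hom.generic, hmap, Matrix.toLin'_apply, ← mapVec_apply_linearMap]

namespace Subsheaf

/-- The largest subsheaf whose fibre at the generic point is `W`. -/
def ofGeneric (a : Fin r → ℤ) (W : Submodule FunctionField (Fin r → FunctionField)) : Subsheaf a :=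
  ofOverlap a (W.comap (mapVec (algebraMap ℂ[T;T⁻¹] FunctionField) (Fin r)))

lemma mem_ofGeneric_sec0 {W : Submodule FunctionField (Fin r → FunctionField)}
    {v : Fin r → ℂ[X]} :
    v ∈ (ofGeneric a W).sec0 ↔ mapVec (algebraMap ℂ[X] FunctionField) (Fin r) v ∈ W := Iff.rfl

lemma isSubbundle_ofGeneric (W : Submodule FunctionField (Fin r → FunctionField)) :
    (ofGeneric a W).IsSubbundle := by
  refine isSubbundle_ofOverlap fun c hc x hx => ?_
  rw [Submodule.mem_comap, map_smulₛₗ] at hx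
  exact (W.smul_mem_iff (IsFractionRing.to_map_eq_zero_iff.not.2 hc)).1 hx

lemma isInvariant_ofGeneric {Φ : Hom a (twistType a n)}
    {W : Submodule FunctionField (Fin r → FunctionField)} (hW : W ∈ (Hom.generic Φ).invtSubmodule) :
    (ofGeneric a W).IsInvariant Φ := by
  refine isInvariant_ofOverlap fun x hx => ?_
  rw [Submodule.mem_comap, Submodule.mem_comap, ← Hom.generic_mapVec_overlap]
  exact hW hx

lemma ofGeneric_ne_bot {W : Submodule FunctionField (Fin r → FunctionField)} (hW : W ≠ ⊥) :
    ofGeneric a W ≠ ⊥ := by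
  obtain ⟨w, hwW, hw⟩ := W.exists_mem_ne_zero_of_ne_bot hW
  obtain ⟨⟨d, hd⟩, hdw⟩ := IsLocalization.exist_integer_multiples_of_finite (nonZeroDivisors ℂ[X]) w
  choose v hv using hdw
  have hvw : mapVec (algebraMap ℂ[X] FunctionField) (Fin r) v = d • w := funext hv
  intro hbot
  have hvmem : v ∈ (ofGeneric a W).sec0 := by
    rw [mem_ofGeneric_sec0, hvw, ← algebraMap_smul FunctionField]
    exact W.smul_mem _ hwW
  have hv0 : v = 0 := by
    rw [hbot] at hvmem
    exact hvmem
  rw [hv0, map_zero, eq_comm, smul_eq_zero] at hvw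
  exact hvw.elim (nonZeroDivisors.ne_zero hd) hw

lemma eq_top_of_ofGeneric_eq_top {W : Submodule FunctionField (Fin r → FunctionField)}
    (h : ofGeneric a W = ⊤) : W = ⊤ := by
  rw [eq_top_iff, ← (Pi.basisFun FunctionField (Fin r)).span_eq, Submodule.span_le]
  rintro _ ⟨i, rfl⟩
  have hi : Pi.single i 1 ∈ (ofGeneric a W).sec0 := by
    rw [h]
    exact Submodule.mem_top
  rwa [mem_ofGeneric_sec0, mapVec_single_one, ← Pi.basisFun_apply] at hi

lemma exists_generic_invariant {Φ : Hom a (twistType a n)} {F : Subsheaf a}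
    (hF : F.IsInvariant Φ) :
    ∃ W ∈ (Hom.generic Φ).invtSubmodule, Module.finrank FunctionField W = F.rank := by
  let f : F.sec0 →ₗ[ℂ[X]] (Fin r → FunctionField) :=
    (Algebra.linearMap ℂ[X] FunctionField).compLeft (Fin r) ∘ₗ F.sec0.subtype
  have hf_inj : Function.Injective f := fun v w h => Subtype.ext <| funext fun i =>
    FaithfulSMul.algebraMap_injective ℂ[X] FunctionField (congrFun h i)
  refine ⟨Submodule.span FunctionField (Set.range f), ?_, finrank_span_range FunctionField hf_inj⟩
  rw [Module.End.mem_invtSubmodule, Submodule.span_le]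
  rintro _ ⟨v, rfl⟩
  exact Submodule.subset_span
    ⟨⟨Hom.on0 Φ v, hF.1 ⟨v, v.2, rfl⟩⟩, (Hom.generic_mapVec_on0 Φ v).symm⟩

end Subsheaf

lemma HasNoInvariantSubbundle.eq_top_of_mem_invtSubmodule {Φ : Hom a (twistType a n)}
    (h : HasNoInvariantSubbundle Φ) {W : Submodule FunctionField (Fin r → FunctionField)}
    (hW : W ∈ (Hom.generic Φ).invtSubmodule) (hbot : W ≠ ⊥) : W = ⊤ := by
  by_contra htop
  exact h (.ofGeneric a W) (Subsheaf.isSubbundle_ofGeneric W) (Subsheaf.ofGeneric_ne_bot hbot)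
    (mt Subsheaf.eq_top_of_ofGeneric_eq_top htop) (Subsheaf.isInvariant_ofGeneric hW)

lemma Subsheaf.IsInvariant.rank_eq {Φ : Hom a (twistType a n)}
    (h : ∀ W ∈ (Hom.generic Φ).invtSubmodule, W ≠ ⊥ → W = ⊤) {F : Subsheaf a}
    (hF : F.IsInvariant Φ) (hbot : F ≠ ⊥) : F.rank = r := by
  obtain ⟨W, hW, hrank⟩ := Subsheaf.exists_generic_invariant hF
  have hW0 : W ≠ ⊥ := by
    rintro rfl
    rw [finrank_bot, Subsheaf.rank, eq_comm, Submodule.finrank_eq_zero] at hrank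
    exact hbot (Subsheaf.eq_bot_of_sec0_eq_bot hrank)
  rw [← hrank, h W hW hW0, finrank_top, Module.finrank_fin_fun]

lemma hasNoInvariantSubbundle_iff (Φ : Hom a (twistType a n)) :
    HasNoInvariantSubbundle Φ ↔ ∀ W ∈ (Hom.generic Φ).invtSubmodule, W ≠ ⊥ → W = ⊤ :=
  ⟨fun h _ hW hbot => h.eq_top_of_mem_invtSubmodule hW hbot,
    fun h _ hF hbot htop hinv => htop (hF.eq_top_of_rank_eq (hinv.rank_eq h hbot))⟩

lemma hasNoInvariantSubbundle_iff_irreducible [NeZero r] (Φ : Hom a (twistType a n)) :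
    HasNoInvariantSubbundle Φ ↔ Irreducible (LinearMap.toMatrix' (Hom.on0 Φ)).charpoly := by
  rw [hasNoInvariantSubbundle_iff, ← irreducible_charpoly_iff, Hom.charpoly_generic,
    ← (Matrix.charpoly_monic _).irreducible_iff_irreducible_map_fraction_map]

end GenericFibre

section Companion

lemma charpoly_eq_of_linearIndependent_pow {R M : Type*} [CommRing R] [Nontrivial R]
    [AddCommGroup M] [Module R M] [Module.Free R M] [Module.Finite R M] {φ : Module.End R M} {d : ℕ}
    (hd : Module.finrank R M = d) {v : M}
    (hv : LinearIndependent R fun k : Fin d => (φ ^ (k : ℕ)) v)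
    {p : R[X]} (hp : p.Monic) (hpd : p.natDegree = d) (hpv : aeval φ p v = 0) :
    φ.charpoly = p := by
  have hlt : (φ.charpoly - p).degree < d := by
    have hdegree : φ.charpoly.degree = p.degree := by
      rw [degree_eq_natDegree φ.charpoly_monic.ne_zero, degree_eq_natDegree hp.ne_zero,
        φ.charpoly_natDegree, hd, hpd]
    rw [← hpd, ← degree_eq_natDegree hp.ne_zero, ← hdegree]
    exact degree_sub_lt_left hdegree φ.charpoly_monic.ne_zero
      (φ.charpoly_monic.leadingCoeff.trans hp.leadingCoeff.symm)
  have hsum : ∑ k : Fin d, (φ.charpoly - p).coeff k • (φ ^ (k : ℕ)) v = 0 := by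
    calc ∑ k : Fin d, (φ.charpoly - p).coeff k • (φ ^ (k : ℕ)) v
        = (φ.charpoly - p).sum fun k c => c • (φ ^ k) v :=
          sum_fin (fun k c => c • (φ ^ k) v) (fun _ => zero_smul R _) hlt
      _ = aeval φ (φ.charpoly - p) v := by
          rw [aeval_def, eval₂_eq_sum, Polynomial.sum, Polynomial.sum, LinearMap.sum_apply]
          rfl
      _ = 0 := by
          rw [map_sub, LinearMap.sub_apply, φ.aeval_self_charpoly, hpv, LinearMap.zero_apply,
            sub_zero]
  refine sub_eq_zero.1 (Polynomial.ext fun k => ?_)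
  obtain hk | hk := lt_or_ge k d
  · exact Fintype.linearIndependent_iff.1 hv _ hsum ⟨k, hk⟩
  · exact coeff_eq_zero_of_degree_lt (hlt.trans_le (Nat.cast_le.2 hk))

lemma irreducible_X_pow_sub_C_of_prime {R : Type*} [CommRing R] [IsDomain R] {p : R} (hp : Prime p)
    {n : ℕ} (hn : n ≠ 0) : Irreducible (X ^ n - Polynomial.C p : R[X]) := by
  have hm : (X ^ n - Polynomial.C p : R[X]).Monic := monic_X_pow_sub_C _ hn
  have hdeg : (X ^ n - Polynomial.C p : R[X]).degree = n :=
    degree_X_pow_sub_C (Nat.pos_of_ne_zero hn) _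
  refine irreducible_of_eisenstein_criterion (P := Ideal.span {p})
    ((Ideal.span_singleton_prime hp.ne_zero).2 hp) ?_ ?_ ?_ ?_ hm.isPrimitive
  · rw [hm.leadingCoeff, Ideal.mem_span_singleton]
    exact fun h => hp.not_isUnit (isUnit_of_dvd_one h)
  · intro k hk
    rw [hdeg, Nat.cast_lt] at hk
    rw [coeff_sub, coeff_X_pow, if_neg hk.ne, zero_sub, coeff_C, neg_mem_iff]
    split_ifs
    · exact Ideal.mem_span_singleton_self p
    · exact zero_mem _
  · rw [hdeg, Nat.cast_pos]
    exact Nat.pos_of_ne_zero hn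
  · rw [coeff_sub, coeff_X_pow, if_neg hn.symm, zero_sub, coeff_C_zero, neg_mem_iff,
      Ideal.span_singleton_pow, Ideal.mem_span_singleton, sq]
    exact fun h => hp.not_isUnit (isUnit_of_dvd_one <|
      (mul_dvd_mul_iff_left hp.ne_zero).1 (by rwa [mul_one]))

/-- The morphism given by compatible matrices over `U₀` and `U₁`. -/
def Hom.ofMatrix {r s : ℕ} {a : Fin r → ℤ} {b : Fin s → ℤ} (M M' : Matrix (Fin s) (Fin r) ℂ[X])
    (h : ∀ i j, fun0 (M i j) * T (a j) = T (b i) * fun1 (M' i j)) : Hom a b :=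
  ⟨(M.mulVecLin, M'.mulVecLin, (M.map fun0).mulVecLin), by
    refine ⟨fun v => ?_, fun v => ?_⟩
    · ext1 i
      exact (RingHom.map_mulVec fun0 M v i).symm
    · ext1 i
      simp only [Matrix.mulVecLin_apply, Matrix.mulVec, dotProduct, res1, Matrix.map_apply, map_sum,
        map_mul, Finset.mul_sum]
      exact Finset.sum_congr rfl fun j _ => by rw [← mul_assoc, h, mul_assoc]⟩

lemma exists_hom_companion {r : ℕ} {a : Fin r → ℤ} (ha : Antitone a) {n : ℤ} (hn : 1 ≤ n)
    (hgap : ∀ (i : ℕ) (hi : i + 1 < r), a ⟨i, Nat.lt_of_succ_lt hi⟩ - n ≤ a ⟨i + 1, hi⟩) :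
    ∃ Φ : Hom a (twistType a n), Hom.on0 Φ = (companion r).mulVecLin := by
  -- The entry `z ^ k` of a map `𝒪(a) → 𝒪(b)` over `U₀` is `w ^ (b - a - k)` over `U₁`.
  refine ⟨Hom.ofMatrix (companion r) (Matrix.of fun i j =>
    if (i : ℕ) = j + 1 then X ^ (a i + n - a j).toNat else
      if (i : ℕ) = 0 ∧ (j : ℕ) + 1 = r then X ^ (a i + n - a j - 1).toNat else 0) ?_, rfl⟩
  intro i j
  simp only [companion, Matrix.of_apply, twistType]
  split_ifs with hij hcorner
  · have hle : a j - n ≤ a i := by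
      convert hgap j (by omega) using 2
      exact Fin.ext hij
    rw [fun1_X_pow, ← T_add, map_one, one_mul]
    congr 1
    omega
  · have hle : a j ≤ a i := ha (Fin.le_def.2 (by omega))
    rw [fun1_X_pow, ← T_add, ← pow_one X, fun0_X_pow, ← T_add]
    congr 1
    push_cast
    omega
  · simp

variable {r : ℕ}

lemma companion_mulVecLin_single {i j : Fin r} (h : (i : ℕ) = j + 1) :
    (companion r).mulVecLin (Pi.single j 1) = Pi.single i 1 := by
  ext1 k
  simp only [Matrix.mulVecLin_apply, Matrix.mulVec_single_one, Matrix.col_apply, companion,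
    Matrix.of_apply, Pi.single_apply, Fin.ext_iff]
  split_ifs <;> first | rfl | omega

lemma companion_mulVecLin_single_last {i j : Fin r} (hi : (i : ℕ) = 0) (hj : (j : ℕ) + 1 = r) :
    (companion r).mulVecLin (Pi.single j 1) = (X : ℂ[X]) • Pi.single i 1 := by
  ext1 k
  simp only [Matrix.mulVecLin_apply, Matrix.mulVec_single_one, Matrix.col_apply, companion,
    Matrix.of_apply, Pi.smul_apply, Pi.single_apply, Fin.ext_iff, smul_eq_mul]
  split_ifs <;> first | omega | simp

variable [NeZero r]

lemma companion_mulVecLin_pow_single (k : Fin r) :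
    ((companion r).mulVecLin ^ (k : ℕ)) (Pi.single 0 1) = Pi.single k 1 := by
  obtain ⟨k, hk⟩ := k
  induction k with
  | zero => rfl
  | succ k ih =>
    rw [pow_succ', Module.End.mul_apply, ih (by omega)]
    exact companion_mulVecLin_single rfl

lemma charpoly_companion : (companion r).charpoly = X ^ r - Polynomial.C X := by
  set φ : Module.End ℂ[X] (Fin r → ℂ[X]) := (companion r).mulVecLin
  have hcharpoly : (companion r).charpoly = φ.charpoly := (Matrix.charpoly_toLin' _).symm
  rw [hcharpoly]
  have hpow : (fun k : Fin r => (φ ^ (k : ℕ)) (Pi.single 0 1)) = Pi.basisFun ℂ[X] (Fin r) :=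
    funext fun k => (companion_mulVecLin_pow_single k).trans (Pi.basisFun_apply _ _ k).symm
  refine charpoly_eq_of_linearIndependent_pow (Module.finrank_fin_fun _) (v := Pi.single 0 1) ?_
    (monic_X_pow_sub_C _ (NeZero.ne r)) natDegree_X_pow_sub_C ?_
  · rw [hpow]
    exact (Pi.basisFun ℂ[X] (Fin r)).linearIndependent
  · have hcycle : (φ ^ r) (Pi.single 0 1) = (X : ℂ[X]) • Pi.single 0 1 := by
      have hr : r - 1 + 1 = r := Nat.sub_add_cancel NeZero.one_le
      let last : Fin r := ⟨r - 1, by omega⟩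
      calc (φ ^ r) (Pi.single 0 1) = φ ((φ ^ (last : ℕ)) (Pi.single 0 1)) := by
            rw [← Module.End.mul_apply, ← pow_succ', hr]
        _ = (X : ℂ[X]) • Pi.single 0 1 := by
            rw [companion_mulVecLin_pow_single]
            exact companion_mulVecLin_single_last (i := 0) (j := last) rfl hr
    rw [map_sub, map_pow, aeval_X, aeval_C, LinearMap.sub_apply, hcycle,
      Module.algebraMap_end_apply, sub_self]

end Companion

section Degree

lemma natDegree_le_of_fun0_eq {f g : ℂ[X]} {e : ℤ} (hf : f ≠ 0) (h : fun0 f = T e * fun1 g) :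
    (f.natDegree : ℤ) ≤ e := by
  have hrev : fun0 g.reverse = fun1 g * T (g.natDegree : ℤ) := toLaurent_reverse g
  have hpoly : X ^ (g.natDegree + (-e).toNat) * f = X ^ e.toNat * g.reverse := by
    apply fun0_injective
    have he : (e.toNat : ℤ) = e + (-e).toNat := by omega
    rw [map_mul, map_mul, fun0_X_pow, fun0_X_pow, h, hrev, he, Nat.cast_add]
    simp only [T_add]
    ring
  have hX (k : ℕ) : (X ^ k : ℂ[X]) ≠ 0 := pow_ne_zero k X_ne_zero
  have hg : g.reverse ≠ 0 := right_ne_zero_of_mul (hpoly ▸ mul_ne_zero (hX _) hf)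
  have hdeg := congrArg natDegree hpoly
  rw [natDegree_mul (hX _) hf, natDegree_mul (hX _) hg, natDegree_X_pow, natDegree_X_pow] at hdeg
  have := reverse_natDegree_le g
  omega

lemma fun0_eq_T_mul_fun1_symm {f g : ℂ[X]} {e : ℤ} (h : fun0 f = T e * fun1 g) :
    fun0 g = T e * fun1 f := by
  have hg : invert (fun1 g) = fun0 g := involutive_invert _
  have hinv : fun1 f = T (-e) * fun0 g := by
    rw [← hg, ← invert_T, ← map_mul, ← h]
    rfl
  rw [hinv, ← mul_assoc, ← T_add, add_neg_cancel, T_zero, one_mul]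

variable {r : ℕ} {a : Fin r → ℤ}

lemma res1_single (a : Fin r → ℤ) (j : Fin r) :
    res1 a (Pi.single j 1) = (T (a j) : ℂ[T;T⁻¹]) • res0 (Pi.single j 1) := by
  ext1 i
  obtain rfl | h := eq_or_ne i j
  · simp [res1, res0]
  · simp [res1, res0, h]

lemma Hom.fun0_on0_single {s : ℕ} {b : Fin s → ℤ} (Φ : Hom a b) (i : Fin s) (j : Fin r) :
    fun0 (Hom.on0 Φ (Pi.single j 1) i) =
      T (b i - a j) * fun1 (Hom.on1 Φ (Pi.single j 1) i) := by
  have h : res1 b (Hom.on1 Φ (Pi.single j 1)) =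
      (T (a j) : ℂ[T;T⁻¹]) • res0 (Hom.on0 Φ (Pi.single j 1)) := by
    rw [Hom.on1, ← Φ.2.2, res1_single, map_smul, Φ.2.1]
    rfl
  have hi : T (b i) * fun1 (Hom.on1 Φ (Pi.single j 1) i) =
      T (a j) * fun0 (Hom.on0 Φ (Pi.single j 1) i) := congrFun h i
  rw [sub_eq_neg_add, T_add, mul_assoc, hi, ← mul_assoc, ← T_add, neg_add_cancel, T_zero, one_mul]

lemma Hom.natDegree_on0_single_le {s : ℕ} {b : Fin s → ℤ} (Φ : Hom a b) (i : Fin s) (j : Fin r) :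
    (Hom.on0 Φ (Pi.single j 1) i).natDegree ≤ (b i - a j).toNat := by
  by_cases h : Hom.on0 Φ (Pi.single j 1) i = 0
  · simp [h]
  · have := natDegree_le_of_fun0_eq h (Hom.fun0_on0_single Φ i j)
    omega

lemma Hom.on0_single_eq_zero {s : ℕ} {b : Fin s → ℤ} (Φ : Hom a b) {i : Fin s} {j : Fin r}
    (h : b i < a j) : Hom.on0 Φ (Pi.single j 1) i = 0 := by
  by_contra h0
  have := natDegree_le_of_fun0_eq h0 (Hom.fun0_on0_single Φ i j)
  omega

lemma prod_T {R ι : Type*} [CommSemiring R] (s : Finset ι) (e : ι → ℤ) :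
    ∏ i ∈ s, (T (e i) : R[T;T⁻¹]) = T (∑ i ∈ s, e i) := by
  classical
  induction s using Finset.induction_on with
  | empty => simp
  | insert i s hi ih => rw [Finset.prod_insert hi, Finset.sum_insert hi, ih, T_add]

section Det

variable {R M ι : Type*} [CommRing R] [AddCommGroup M] [Module R M] [Fintype ι] [DecidableEq ι]

lemma eq_top_of_isUnit_det (e : Module.Basis ι R M) {N : Submodule R M} {v : ι → M}
    (hv : ∀ i, v i ∈ N) (h : IsUnit (e.det v)) : N = ⊤ := by
  rw [eq_top_iff, ← (e.is_basis_iff_det.2 h).2, Submodule.span_le]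
  exact Set.range_subset_iff.2 hv

lemma det_ne_zero_of_linearIndependent [IsDomain R] (e : Module.Basis ι R M) {v : ι → M}
    (hv : LinearIndependent R v) : e.det v ≠ 0 := by
  intro h
  obtain ⟨c, hc, hcv⟩ := Matrix.exists_mulVec_eq_zero_iff.2 h
  refine hc (funext (Fintype.linearIndependent_iff.1 hv c
    (e.repr.injective (Finsupp.ext fun i => ?_))))
  simpa [Matrix.mulVec, dotProduct, Module.Basis.toMatrix_apply, mul_comm] using congrFun hcv i

end Det

namespace Subsheaf

lemma HasDegree.exists_fun0_det_eq {F : Subsheaf a} {d : ℤ} (h : F.HasDegree d)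
    (hF : F.rank = r) :
    ∃ (b0 : Module.Basis (Fin r) ℂ[X] F.sec0) (b1 : Module.Basis (Fin r) ℂ[X] F.sec1) (c : ℂ),
      c ≠ 0 ∧
        fun0 (Polynomial.C c *
          (Pi.basisFun ℂ[X] (Fin r)).det fun j => (b0 j : Fin r → ℂ[X])) =
        T (∑ i, a i - d) *
          fun1 ((Pi.basisFun ℂ[X] (Fin r)).det fun j => (b1 j : Fin r → ℂ[X])) := by
  obtain ⟨s, b0, b1, P, c, hP, hc, hd⟩ := h
  obtain rfl : s = r := by rw [← hF, rank, Module.finrank_eq_card_basis b0, Fintype.card_fin]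
  refine ⟨b0, b1, c, hc, ?_⟩
  rw [Module.Basis.det_apply, Module.Basis.det_apply]
  set B0 := (Pi.basisFun ℂ[X] (Fin s)).toMatrix fun j => (b0 j : Fin s → ℂ[X])
  set B1 := (Pi.basisFun ℂ[X] (Fin s)).toMatrix fun j => (b1 j : Fin s → ℂ[X])
  have htransition : Matrix.diagonal (fun i => (T (a i) : ℂ[T;T⁻¹])) * fun1.mapMatrix B1 =
      fun0.mapMatrix B0 * P := by
    ext1 i j
    rw [Matrix.diagonal_mul, Matrix.mul_apply]
    refine (congrFun (hP j) i).trans ?_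
    rw [Finset.sum_apply]
    exact Finset.sum_congr rfl fun k _ => mul_comm _ _
  have hdet := congrArg Matrix.det htransition
  rw [Matrix.det_mul, Matrix.det_mul, Matrix.det_diagonal, prod_T, hd, ← RingHom.map_det,
    ← RingHom.map_det] at hdet
  have hC : fun0 (Polynomial.C c) = LaurentPolynomial.C c := toLaurent_C c
  calc fun0 (Polynomial.C c * B0.det)
      = fun0 B0.det * (LaurentPolynomial.C c * T d) * T (-d) := by
        rw [map_mul, hC, ← mul_assoc, mul_T_assoc, add_neg_cancel, T_zero, mul_one, mul_comm]
    _ = T (∑ i, a i - d) * fun1 B1.det := by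
        rw [← hdet, sub_eq_add_neg, T_add]
        ring

lemma degree_lt_of_rank_eq {F : Subsheaf a} (hF : F.rank = r) (htop : F ≠ ⊤) :
    F.degree < ∑ i, a i := by
  obtain ⟨b0, b1, c, hc, h⟩ := F.hasDegree_degree.exists_fun0_det_eq hF
  have hdet0 := det_ne_zero_of_linearIndependent (Pi.basisFun ℂ[X] _) (linearIndependent_coe b0)
  have hdet1 := det_ne_zero_of_linearIndependent (Pi.basisFun ℂ[X] _) (linearIndependent_coe b1)
  have hdeg0 := natDegree_le_of_fun0_eq (mul_ne_zero (Polynomial.C_ne_zero.2 hc) hdet0) h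
  have hdeg1 := natDegree_le_of_fun0_eq hdet1 (fun0_eq_T_mul_fun1_symm h)
  rw [natDegree_C_mul hc] at hdeg0
  by_contra hlt
  have isUnit_of_natDegree_le {f : ℂ[X]} (hf : f ≠ 0)
      (hdeg : (f.natDegree : ℤ) ≤ ∑ i, a i - F.degree) : IsUnit f := by
    rw [Polynomial.isUnit_iff_degree_eq_zero, degree_eq_natDegree hf, Nat.cast_eq_zero]
    omega
  exact htop (Subsheaf.ext
    (eq_top_of_isUnit_det _ (fun j => (b0 j).2) (isUnit_of_natDegree_le hdet0 hdeg0))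
    (eq_top_of_isUnit_det _ (fun j => (b1 j).2) (isUnit_of_natDegree_le hdet1 hdeg1)))

lemma hasDegree_of_basis {F : Subsheaf a} {ι : Type*} [Fintype ι]
    (b0 : Module.Basis ι ℂ[X] F.sec0) (b1 : Module.Basis ι ℂ[X] F.sec1) {d : ι → ℤ}
    (h : ∀ i, res1 a (b1 i : Fin r → ℂ[X]) =
      (T (d i) : ℂ[T;T⁻¹]) • res0 (b0 i : Fin r → ℂ[X])) : F.HasDegree (∑ i, d i) := by
  let e := Fintype.equivFin ι
  refine ⟨Fintype.card ι, b0.reindex e, b1.reindex e,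
    Matrix.diagonal fun j => T (d (e.symm j)), 1, fun j => ?_, one_ne_zero, ?_⟩
  · rw [Finset.sum_eq_single j (fun i _ hij => by rw [Matrix.diagonal_apply_ne _ hij, zero_smul])
      (fun hj => absurd (Finset.mem_univ j) hj), Matrix.diagonal_apply_eq,
      Module.Basis.reindex_apply, Module.Basis.reindex_apply, h]
  · rw [Matrix.det_diagonal, prod_T, map_one, one_mul, e.symm.sum_comp d]

end Subsheaf

end Degree

section Coordinate

lemma exists_basis_spanSubset {R ι : Type*} [Semiring R] [Finite ι] [DecidableEq ι] (s : Set ι) :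
    ∃ b : Module.Basis s R (Pi.spanSubset R s), ∀ i, (b i : ι → R) = Pi.single (i : ι) 1 := by
  have hli := (Pi.basisFun R ι).linearIndependent.comp ((↑) : s → ι) Subtype.val_injective
  have hspan : Submodule.span R (Set.range (Pi.basisFun R ι ∘ ((↑) : s → ι))) =
      Pi.spanSubset R s := by
    rw [Pi.spanSubset, Set.range_comp, Subtype.range_coe]
  refine ⟨(Module.Basis.span hli).map (LinearEquiv.ofEq _ _ hspan), fun i => ?_⟩
  simp [Module.Basis.span_apply]

variable {r : ℕ} {a : Fin r → ℤ} {n : ℤ}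

namespace Subsheaf

/-- The direct summand `⨁ i ∈ s, 𝒪(aᵢ)` of `⨁ᵢ 𝒪(aᵢ)`. -/
def coord (a : Fin r → ℤ) (s : Finset (Fin r)) : Subsheaf a :=
  ofOverlap a (Pi.spanSubset ℂ[T;T⁻¹] s)

lemma coord_sec0 (s : Finset (Fin r)) : (coord a s).sec0 = Pi.spanSubset ℂ[X] s := by
  ext v
  simp only [coord, mem_ofOverlap_sec0, Pi.mem_spanSubset_iff, res0,
    map_eq_zero_iff fun0 fun0_injective]

lemma coord_sec1 (s : Finset (Fin r)) : (coord a s).sec1 = Pi.spanSubset ℂ[X] s := by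
  ext v
  simp only [coord, mem_ofOverlap_sec1, Pi.mem_spanSubset_iff, res1,
    (isUnit_T (R := ℂ) _).mul_right_eq_zero, map_eq_zero_iff fun1 fun1_injective]

lemma rank_coord (s : Finset (Fin r)) : (coord a s).rank = s.card := by
  rw [rank, coord_sec0, Pi.dim_spanSubset, Set.ncard_coe_finset]

lemma degree_coord (s : Finset (Fin r)) : (coord a s).degree = ∑ i ∈ s, a i := by
  obtain ⟨b, hb⟩ := exists_basis_spanSubset (R := ℂ[X]) (s : Set (Fin r))
  rw [← Finset.sum_coe_sort]
  refine (hasDegree_degree _).unique (hasDegree_of_basis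
    (b.map (LinearEquiv.ofEq _ _ (coord_sec0 s).symm))
    (b.map (LinearEquiv.ofEq _ _ (coord_sec1 s).symm)) fun i => ?_)
  simp only [Module.Basis.map_apply, LinearEquiv.coe_ofEq_apply, hb, res1_single]

lemma coord_univ : coord a Finset.univ = ⊤ := by
  have h : Pi.spanSubset ℂ[X] ((Finset.univ : Finset (Fin r)) : Set (Fin r)) = ⊤ := by
    ext v
    simp [Pi.mem_spanSubset_iff]
  exact Subsheaf.ext ((coord_sec0 _).trans h) ((coord_sec1 _).trans h)

lemma rank_top : (⊤ : Subsheaf a).rank = r := by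
  rw [← coord_univ, rank_coord, Finset.card_univ, Fintype.card_fin]

lemma degree_top : (⊤ : Subsheaf a).degree = ∑ i, a i := by
  rw [← coord_univ, degree_coord]

lemma rank_bot : (⊥ : Subsheaf a).rank = 0 := finrank_bot _ _

lemma isInvariant_coord {s : Finset (Fin r)} (h : ∀ i ∉ s, ∀ j ∈ s, a i + n < a j)
    (Φ : Hom a (twistType a n)) : (coord a s).IsInvariant Φ := by
  refine isInvariant_ofOverlap (Submodule.span_le.2 ?_)
  rintro _ ⟨j, hj, rfl⟩
  refine Pi.mem_spanSubset_iff.2 fun i hi => ?_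
  rw [Pi.basisFun_apply, ← LinearMap.toMatrix'_apply, Hom.toMatrix'_overlap, Matrix.map_apply,
    LinearMap.toMatrix'_apply, Hom.on0_single_eq_zero Φ (h i hi j hj), map_zero]

end Subsheaf

lemma HasNoInvariantSubbundle.isStable [NeZero r] {Φ : Hom a (twistType a n)}
    (h : HasNoInvariantSubbundle Φ) : IsStable Φ := by
  intro F hbot htop hinv
  have hF : F.rank = r := hinv.rank_eq ((hasNoInvariantSubbundle_iff Φ).1 h) hbot
  have hr : (0 : ℚ) < r := Nat.cast_pos.2 (NeZero.pos r)
  rw [Subsheaf.slope, Subsheaf.slope, hF, Subsheaf.rank_top, Subsheaf.degree_top]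
  gcongr
  exact Subsheaf.degree_lt_of_rank_eq hF htop

lemma card_nsmul_sum_univ_lt {ι M : Type*} [Fintype ι] [DecidableEq ι] [AddCommMonoid M]
    [PartialOrder M] [IsOrderedCancelAddMonoid M] {s : Finset ι} (hs : s.Nonempty)
    (hs' : sᶜ.Nonempty) {f : ι → M} (h : ∀ i ∈ s, ∀ j ∉ s, f j < f i) :
    s.card • ∑ i, f i < Fintype.card ι • ∑ i ∈ s, f i := by
  have hlt : s.card • ∑ j ∈ sᶜ, f j < sᶜ.card • ∑ i ∈ s, f i := by
    calc s.card • ∑ j ∈ sᶜ, f j = ∑ _i ∈ s, ∑ j ∈ sᶜ, f j := (Finset.sum_const _).symm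
      _ < ∑ i ∈ s, ∑ _j ∈ sᶜ, f i := Finset.sum_lt_sum_of_nonempty hs fun i hi =>
          Finset.sum_lt_sum_of_nonempty hs' fun j hj => h i hi j (Finset.mem_compl.1 hj)
      _ = sᶜ.card • ∑ i ∈ s, f i := by simp only [Finset.sum_const, Finset.smul_sum]
  rw [← s.sum_add_sum_compl f, ← s.card_add_card_compl, smul_add, add_smul]
  gcongr

lemma IsSemistable.exists_le_add (hn : 0 ≤ n) {Φ : Hom a (twistType a n)} (h : IsSemistable Φ)
    {s : Finset (Fin r)} (hs : s.Nonempty) (hs' : sᶜ.Nonempty) :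
    ∃ i ∉ s, ∃ j ∈ s, a j ≤ a i + n := by
  by_contra! hgap
  have hcard : s.card < r := by
    have := hs'.card_pos
    rw [Finset.card_compl, Fintype.card_fin] at this
    omega
  have hbot : Subsheaf.coord a s ≠ ⊥ := fun h0 => hs.card_ne_zero <| by
    rw [← Subsheaf.rank_coord (a := a), h0, Subsheaf.rank_bot]
  have htop : Subsheaf.coord a s ≠ ⊤ := fun h1 => hcard.ne <| by
    rw [← Subsheaf.rank_coord (a := a), h1, Subsheaf.rank_top]
  have hslope := h _ hbot htop (Subsheaf.isInvariant_coord hgap Φ)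
  have hcard0 : 0 < s.card := hs.card_pos
  rw [Subsheaf.slope, Subsheaf.slope, Subsheaf.rank_coord, Subsheaf.rank_top, Subsheaf.degree_top,
    Subsheaf.degree_coord, div_le_div_iff₀ (by positivity) (by norm_cast; omega)] at hslope
  have hlt := card_nsmul_sum_univ_lt hs hs' (f := a) fun j hj i hi => by
    have := hgap i hi j hj
    omega
  rw [nsmul_eq_mul, nsmul_eq_mul, Fintype.card_fin] at hlt
  have hle : (∑ i ∈ s, a i) * r ≤ (∑ i, a i) * s.card := by exact_mod_cast hslope
  linarith

lemma IsSemistable.gap_le (ha : Antitone a) (hn : 0 ≤ n) {Φ : Hom a (twistType a n)}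
    (h : IsSemistable Φ) (i : ℕ) (hi : i + 1 < r) :
    a ⟨i, Nat.lt_of_succ_lt hi⟩ - n ≤ a ⟨i + 1, hi⟩ := by
  obtain ⟨k, hk, j, hj, hjk⟩ := h.exists_le_add hn
    (s := Finset.Iic ⟨i, Nat.lt_of_succ_lt hi⟩) ⟨_, Finset.mem_Iic.2 le_rfl⟩
    ⟨⟨i + 1, hi⟩, by simp⟩
  rw [Finset.mem_Iic, not_le] at hk
  have hak : a k ≤ a ⟨i + 1, hi⟩ := ha (Fin.le_def.2 (Fin.lt_def.1 hk))
  have haj : a ⟨i, Nat.lt_of_succ_lt hi⟩ ≤ a j := ha (Finset.mem_Iic.1 hj)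
  omega

end Coordinate

section BivariateDegree

lemma coeff_coeff_swap {R : Type*} [CommSemiring R] (p : R[X][X]) (i j : ℕ) :
    ((Bivariate.swap p).coeff i).coeff j = (p.coeff j).coeff i := by
  induction p using Polynomial.induction_on' with
  | add p q hp hq => simp only [map_add, coeff_add, hp, hq]
  | monomial n f =>
    induction f using Polynomial.induction_on' with
    | add p q hp hq => simp only [map_add, coeff_add, hp, hq]
    | monomial m c =>
      rw [Bivariate.swap_monomial_monomial]
      simp only [coeff_monomial]
      split_ifs <;> simp [coeff_monomial, *]

lemma natDegree_coeff_le_natDegree_swap {R : Type*} [CommSemiring R] (p : R[X][X]) (i : ℕ) :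
    (p.coeff i).natDegree ≤ (Bivariate.swap p).natDegree :=
  natDegree_le_iff_coeff_eq_zero.2 fun j hj => by
    rw [← coeff_coeff_swap, coeff_eq_zero_of_natDegree_lt hj, coeff_zero]

lemma natDegree_swap_map_le {R S : Type*} [CommSemiring R] [CommSemiring S] (f : R →+* S)
    (p : R[X][X]) :
    (Bivariate.swap (p.map (mapRingHom f))).natDegree ≤ (Bivariate.swap p).natDegree := by
  have h : Bivariate.swap (p.map (mapRingHom f)) = (Bivariate.swap p).map (mapRingHom f) := by
    ext i j
    simp only [coeff_coeff_swap, coeff_map, coe_mapRingHom]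
  exact h ▸ natDegree_map_le

lemma natDegree_swap_le_of_dvd {R : Type*} [CommRing R] [IsDomain R] {p q : R[X][X]}
    (h : p ∣ q) (hq : q ≠ 0) : (Bivariate.swap p).natDegree ≤ (Bivariate.swap q).natDegree := by
  have hdvd : Bivariate.swap p ∣ Bivariate.swap q := by
    obtain ⟨g, rfl⟩ := h
    rw [map_mul]
    exact dvd_mul_right _ _
  exact natDegree_le_of_dvd hdvd ((map_ne_zero_iff _ Bivariate.swap.injective).2 hq)

end BivariateDegree

section Families

lemma dvd_of_forall_map_dvd {Z A : Type*} {B : Z → Type*} [CommRing A] [∀ z, CommRing (B z)]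
    (φ : ∀ z, A →+* B z) (hφ : ∀ x, (∀ z, φ z x = 0) → x = 0) {p q : A[X]} (hp : p.Monic)
    (h : ∀ z, p.map (φ z) ∣ q.map (φ z)) : p ∣ q := by
  rw [← modByMonic_eq_zero_iff_dvd hp]
  ext i
  refine hφ _ fun z => ?_
  rw [← coeff_map, map_modByMonic _ hp, (modByMonic_eq_zero_iff_dvd (hp.map _)).2 (h z), coeff_zero]

lemma exists_map_evalRingHom_eq {Z : Type*} {R : Z → Type*} [∀ z, Semiring (R z)]
    (q : ∀ z, (R z)[X]) {N : ℕ} (hN : ∀ z, (q z).natDegree ≤ N) :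
    ∃ Q : (∀ z, R z)[X], ∀ z, Q.map (Pi.evalRingHom R z) = q z := by
  refine ⟨∑ i ∈ Finset.range (N + 1), monomial i fun z => (q z).coeff i, fun z => ?_⟩
  rw [Polynomial.map_sum, (q z).as_sum_range' (N + 1) (Nat.lt_succ_of_le (hN z))]
  simp only [map_monomial, Pi.evalRingHom_apply]

lemma exists_isMonicOfDegree_map_evalRingHom_eq {Z R : Type*} [Nonempty Z] [CommRing R]
    [Nontrivial R] (f : Z → R[X][X]) {s N : ℕ} (hf : ∀ z, (f z).IsMonicOfDegree s)
    (hN : ∀ z, (Bivariate.swap (f z)).natDegree ≤ N) :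
    ∃ F : (Z → R)[X][X], F.IsMonicOfDegree s ∧
      ∀ z, F.map (mapRingHom (Pi.evalRingHom (fun _ => R) z)) = f z := by
  choose c hc using fun i => exists_map_evalRingHom_eq (fun z => (f z).coeff i)
    fun z => (natDegree_coeff_le_natDegree_swap (f z) i).trans (hN z)
  have hdeg : (∑ i ∈ Finset.range s, Polynomial.C (c i) * X ^ i).degree < (s : WithBot ℕ) := by
    refine (degree_sum_le _ _).trans_lt
      ((Finset.sup_lt_iff (WithBot.bot_lt_coe s)).2 fun i hi => ?_)
    exact (degree_C_mul_X_pow_le _ _).trans_lt (Nat.cast_lt.2 (Finset.mem_range.1 hi))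
  refine ⟨X ^ s + ∑ i ∈ Finset.range s, Polynomial.C (c i) * X ^ i,
    ⟨?_, monic_X_pow_add hdeg⟩, fun z => ?_⟩
  · rw [natDegree_add_eq_left_of_degree_lt (hdeg.trans_eq (degree_X_pow s).symm), natDegree_X_pow]
  rw [(hf z).monic.as_sum, (hf z).natDegree_eq]
  simp only [Polynomial.map_add, Polynomial.map_pow, map_X, Polynomial.map_sum,
    Polynomial.map_mul, map_C, coe_mapRingHom, hc]

lemma exists_iInf_fiber_le {A Z ι : Type*} [CommSemiring A] {P : Ideal A} (hP : P.IsPrime)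
    {I : Z → Ideal A} (hI : ⨅ z, I z ≤ P) {s : Z → ι} {S : Finset ι} (hs : ∀ z, s z ∈ S) :
    ∃ d ∈ S, ⨅ z : {z // s z = d}, I z ≤ P := by
  refine hP.inf_le'.1 (le_trans (le_iInf fun z => ?_) hI)
  exact (Finset.inf_le (hs z)).trans (iInf_le (fun w : {w // s w = s z} => I w) ⟨z, rfl⟩)

end Families

section IntegralExtension

lemma exists_comp_algebraMap_eq {R S k : Type*} [CommRing R] [CommRing S] [Algebra R S]
    [Algebra.IsIntegral R S] [Field k] [IsAlgClosed k] {x : R →+* k}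
    (h : RingHom.ker (algebraMap R S) ≤ RingHom.ker x) :
    ∃ y : S →+* k, y.comp (algebraMap R S) = x := by
  have := RingHom.ker_isPrime x
  obtain ⟨Q, -, hQ, hcomap⟩ := Ideal.exists_ideal_over_prime_of_isIntegral (S := S)
    (RingHom.ker x) ⊥ h
  have : Q.LiesOver (RingHom.ker x) := ⟨hcomap.symm⟩
  let _ : Algebra (R ⧸ RingHom.ker x) k := (RingHom.kerLift x).toAlgebra
  have : FaithfulSMul (R ⧸ RingHom.ker x) k :=
    (faithfulSMul_iff_algebraMap_injective _ _).2 (RingHom.kerLift_injective x)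
  have : Module.IsTorsionFree (R ⧸ RingHom.ker x) (S ⧸ Q) :=
    Module.isTorsionFree_iff_faithfulSMul.2 inferInstance
  let y : S ⧸ Q →ₐ[R ⧸ RingHom.ker x] k := IsAlgClosed.lift
  refine ⟨(y : S ⧸ Q →+* k).comp (Ideal.Quotient.mk Q), RingHom.ext fun p => ?_⟩
  exact y.commutes (Ideal.Quotient.mk _ p)

lemma exists_map_integralClosure_eq_of_dvd {R B : Type*} [CommRing R] [CommRing B] [Algebra R B]
    {χ : R[X][X]} {F : B[X][X]} (hχ : χ.Monic) (hF : F.Monic)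
    (h : F ∣ χ.map (mapRingHom (algebraMap R B))) :
    ∃ F' : (integralClosure R B)[X][X],
      F'.map (mapRingHom (algebraMap (integralClosure R B) B)) = F := by
  let _ : Algebra R[X] B[X] := Polynomial.algebra R B
  have hcoeff : ∀ i j, IsIntegral R ((F.coeff i).coeff j) := fun i j =>
    (isIntegral_coeff_of_dvd χ F hχ hF h i).coeff j
  exact (lifts_iff_coeff_lifts F).2 fun i =>
    (lifts_iff_coeff_lifts (F.coeff i)).2 fun j => ⟨⟨_, hcoeff i j⟩, rfl⟩

lemma exists_isMonicOfDegree_dvd_map {R B k : Type*} [CommRing R] [CommRing B] [Algebra R B]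
    [Field k] [IsAlgClosed k] {x : R →+* k} (hx : RingHom.ker (algebraMap R B) ≤ RingHom.ker x)
    {χ : R[X][X]} (hχ : χ.Monic) {s : ℕ} {F : B[X][X]} (hF : F.IsMonicOfDegree s)
    (h : F ∣ χ.map (mapRingHom (algebraMap R B))) :
    ∃ f : k[X][X], f.IsMonicOfDegree s ∧ f ∣ χ.map (mapRingHom x) := by
  obtain ⟨F', rfl⟩ := exists_map_integralClosure_eq_of_dvd hχ hF.monic h
  let S := integralClosure R B
  have hinj : Function.Injective (algebraMap S B) := Subtype.val_injective
  have hker : RingHom.ker (algebraMap R S) ≤ RingHom.ker x := by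
    rwa [IsScalarTower.algebraMap_eq R S B, RingHom.ker_comp_of_injective _ hinj] at hx
  obtain ⟨y, rfl⟩ := exists_comp_algebraMap_eq hker
  have hinj' : Function.Injective (mapRingHom (algebraMap S B)) := Polynomial.map_injective _ hinj
  have hmonic : F'.Monic := monic_of_injective hinj' hF.monic
  have hdvd : F' ∣ χ.map (mapRingHom (algebraMap R S)) := by
    rwa [IsScalarTower.algebraMap_eq R S B, ← mapRingHom_comp, ← Polynomial.map_map,
      map_dvd_map _ hinj' hmonic] at h
  refine ⟨F'.map (mapRingHom y), ⟨?_, hmonic.map _⟩, ?_⟩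
  · rw [hmonic.natDegree_map, ← hF.natDegree_eq, natDegree_map_eq_of_injective hinj']
  · rw [← mapRingHom_comp, ← Polynomial.map_map]
    exact Polynomial.map_dvd _ hdvd

end IntegralExtension

section Specialization

variable {R k Z : Type*} [CommRing R] [Field k] {pt : Z → R →+* k} {x : R →+* k}
  {χ : R[X][X]}

lemma not_irreducible_map_iff (hχ : χ.Monic) (hχ1 : χ ≠ 1) (w : R →+* k) :
    ¬ Irreducible (χ.map (mapRingHom w)) ↔ ∃ s ∈ Finset.Ioc 0 (χ.natDegree / 2),
      ∃ f : k[X][X], f.IsMonicOfDegree s ∧ f ∣ χ.map (mapRingHom w) := by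
  have hw : χ.map (mapRingHom w) ≠ 1 := fun hw => hχ1 <| by
    rwa [← hχ.natDegree_eq_zero, ← hχ.natDegree_map (mapRingHom w), (hχ.map _).natDegree_eq_zero]
  rw [(hχ.map _).irreducible_iff_lt_natDegree_lt hw, hχ.natDegree_map]
  push Not
  exact ⟨fun ⟨f, hf, hs, hdvd⟩ => ⟨_, hs, f, ⟨rfl, hf⟩, hdvd⟩,
    fun ⟨s, hs, f, hf, hdvd⟩ => ⟨f, hf.monic, hf.natDegree_eq ▸ hs, hdvd⟩⟩

variable [IsAlgClosed k]

lemma exists_isMonicOfDegree_dvd_map_of_iInf_ker_le (hx : ⨅ z, RingHom.ker (pt z) ≤ RingHom.ker x)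
    (hχ : χ.Monic) {s : ℕ}
    (h : ∀ z, ∃ f : k[X][X], f.IsMonicOfDegree s ∧ f ∣ χ.map (mapRingHom (pt z))) :
    ∃ f : k[X][X], f.IsMonicOfDegree s ∧ f ∣ χ.map (mapRingHom x) := by
  choose f hf hfχ using h
  have : Nonempty Z := by
    by_contra hZ
    rw [not_nonempty_iff] at hZ
    rw [iInf_of_empty, top_le_iff] at hx
    exact RingHom.ker_ne_top x hx
  obtain ⟨F, hF, hFf⟩ := exists_isMonicOfDegree_map_evalRingHom_eq f hf fun z =>
    (natDegree_swap_le_of_dvd (hfχ z) (hχ.map _).ne_zero).trans (natDegree_swap_map_le (pt z) χ)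
  let _ : Algebra R (Z → k) := (RingHom.pi pt).toAlgebra
  refine exists_isMonicOfDegree_dvd_map (B := Z → k) (fun p hp => hx ?_) hχ hF ?_
  · exact Ideal.mem_iInf.2 fun z => congrFun hp z
  · refine dvd_of_forall_map_dvd (fun z => mapRingHom (Pi.evalRingHom (fun _ => k) z))
      (fun p hp => ?_) hF.monic fun z => ?_
    · ext i z
      simpa using congrArg (coeff · i) (hp z)
    · rw [hFf, Polynomial.map_map, mapRingHom_comp]
      exact hfχ z

lemma not_irreducible_map_of_iInf_ker_le (hx : ⨅ z, RingHom.ker (pt z) ≤ RingHom.ker x)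
    (hχ : χ.Monic) (h : ∀ z, ¬ Irreducible (χ.map (mapRingHom (pt z)))) :
    ¬ Irreducible (χ.map (mapRingHom x)) := by
  by_cases hχ1 : χ = 1
  · rw [hχ1, Polynomial.map_one]
    exact not_irreducible_one
  choose s hs hdvd using fun z => (not_irreducible_map_iff hχ hχ1 (pt z)).1 (h z)
  obtain ⟨d, hd, hle⟩ := exists_iInf_fiber_le (RingHom.ker_isPrime x) hx hs
  refine (not_irreducible_map_iff hχ hχ1 x).2
    ⟨d, hd, exists_isMonicOfDegree_dvd_map_of_iInf_ker_le hle hχ ?_⟩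
  rintro ⟨z, rfl⟩
  exact hdvd z

lemma not_irreducible_charpoly_map_of_iInf_ker_le {m : Type*} [Fintype m] [DecidableEq m]
    {M : Matrix m m R[X]} (hx : ⨅ z, RingHom.ker (pt z) ≤ RingHom.ker x)
    (h : ∀ z, ¬ Irreducible (M.map (mapRingHom (pt z))).charpoly) :
    ¬ Irreducible (M.map (mapRingHom x)).charpoly := by
  simp only [Matrix.charpoly_map] at h ⊢
  exact not_irreducible_map_of_iInf_ker_le hx M.charpoly_monic h

end Specialization

section Openness

/-- Evaluation of polynomial functions at a point. -/
def evalAt {V : Type*} [AddCommGroup V] [Module ℂ V] (v : V) : polyFun V →+* ℂ :=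
  (Pi.evalRingHom (fun _ : V => ℂ) v).comp (polyFun V).val

lemma isZariskiOpen_of_iInf_ker_evalAt_le {V : Type*} [AddCommGroup V] [Module ℂ V] {U : Set V}
    (h : ∀ x, ⨅ v : ↥Uᶜ, RingHom.ker (evalAt (v : V)) ≤ RingHom.ker (evalAt x) → x ∉ U) :
    IsZariskiOpen U := by
  refine ⟨{f | f ∈ polyFun V ∧ ∀ v ∈ Uᶜ, f v = 0}, fun f hf => hf.1, Set.ext fun x => ?_⟩
  refine ⟨fun hx f hf => hf.2 x hx, fun hx => h x fun f hf => hx f ⟨f.2, fun v hv => ?_⟩⟩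
  exact Ideal.mem_iInf.1 hf ⟨v, hv⟩

lemma isZariskiOpen_irreducible_charpoly {V m : Type*} [AddCommGroup V] [Module ℂ V] [Fintype m]
    [DecidableEq m] (M : Matrix m m (polyFun V)[X]) :
    IsZariskiOpen {v | Irreducible (M.map (mapRingHom (evalAt v))).charpoly} :=
  isZariskiOpen_of_iInf_ker_evalAt_le fun _ hx =>
    not_irreducible_charpoly_map_of_iInf_ker_le hx fun v => v.2

variable {r s : ℕ}

/-- The coefficient of `z ^ d` in the `(i, j)` entry of the matrix of a morphism over `U₀`. -/
def coeffForm (a : Fin r → ℤ) (b : Fin s → ℤ) (i : Fin s) (j : Fin r) (d : ℕ) :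
    Module.Dual ℂ (Hom a b) where
  toFun Φ := (Hom.on0 Φ (Pi.single j 1) i).coeff d
  map_add' Φ Ψ := by simp [Hom.on0]
  map_smul' c Φ := by simp [Hom.on0]

/-- The matrix over `U₀` of the universal morphism, whose coefficients are polynomial functions
on the space of morphisms. -/
def genericMatrix (a : Fin r → ℤ) (b : Fin s → ℤ) :
    Matrix (Fin s) (Fin r) (polyFun (Hom a b))[X] :=
  Matrix.of fun i j => ∑ d ∈ Finset.range ((b i - a j).toNat + 1),
    monomial d ⟨coeffForm a b i j d, Algebra.subset_adjoin ⟨_, rfl⟩⟩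

lemma genericMatrix_map_evalAt {a : Fin r → ℤ} {b : Fin s → ℤ} (Φ : Hom a b) :
    (genericMatrix a b).map (mapRingHom (evalAt Φ)) = LinearMap.toMatrix' (Hom.on0 Φ) := by
  ext1 i j
  have hdeg := Hom.natDegree_on0_single_le Φ i j
  rw [LinearMap.toMatrix'_apply,
    (Hom.on0 Φ (Pi.single j 1) i).as_sum_range' _ (Nat.lt_succ_of_le hdeg)]
  simp only [genericMatrix, Matrix.map_apply, Matrix.of_apply, coe_mapRingHom,
    Polynomial.map_sum, map_monomial]
  rfl

lemma isZariskiOpen_hasNoInvariantSubbundle [NeZero r] {a : Fin r → ℤ} {n : ℤ} :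
    IsZariskiOpen {Φ : Hom a (twistType a n) | HasNoInvariantSubbundle Φ} := by
  convert isZariskiOpen_irreducible_charpoly (genericMatrix a (twistType a n)) using 3 with Φ
  rw [hasNoInvariantSubbundle_iff_irreducible, genericMatrix_map_evalAt]

end Openness

end P1

end

theorem proposition5p1 {r : ℕ} (hr : 2 ≤ r) (a : Fin r → ℤ) (ha : Antitone a)
    (ℓ : ℤ) (hℓ : -1 ≤ ℓ) :
    (∀ Φ : P1.Hom a (P1.twistType a (2 + ℓ)), P1.IsSemistable Φ →
      ∀ (i : ℕ) (hi : i + 1 < r), a ⟨i + 1, hi⟩ ≥ a ⟨i, by omega⟩ - ℓ - 2) ∧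
    ((∀ (i : ℕ) (hi : i + 1 < r), a ⟨i + 1, hi⟩ ≥ a ⟨i, by omega⟩ - ℓ - 2) →
      (∃ Φ : P1.Hom a (P1.twistType a (2 + ℓ)), P1.HasNoInvariantSubbundle Φ ∧ P1.IsStable Φ ∧
        P1.Hom.on0 Φ = (P1.companion r).mulVecLin ∧ Irreducible (P1.companion r).charpoly) ∧
      (∀ Φ : P1.Hom a (P1.twistType a (2 + ℓ)), P1.HasNoInvariantSubbundle Φ → P1.IsStable Φ) ∧
      {Φ : P1.Hom a (P1.twistType a (2 + ℓ)) | P1.HasNoInvariantSubbundle Φ}.Nonempty ∧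
      P1.IsZariskiOpen {Φ : P1.Hom a (P1.twistType a (2 + ℓ)) | P1.HasNoInvariantSubbundle Φ}) := by
  have : NeZero r := ⟨by omega⟩
  refine ⟨fun Φ hΦ i hi => ?_, fun hgap => ?_⟩
  · have := hΦ.gap_le ha (by omega) i hi
    omega
  have hirr : Irreducible (P1.companion r).charpoly := by
    rw [P1.charpoly_companion]
    exact P1.irreducible_X_pow_sub_C_of_prime prime_X (NeZero.ne r)
  obtain ⟨Φ, hΦ⟩ := P1.exists_hom_companion ha (n := 2 + ℓ) (by omega) fun i hi => by
    have := hgap i hi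
    omega
  have hno : P1.HasNoInvariantSubbundle Φ := by
    rwa [P1.hasNoInvariantSubbundle_iff_irreducible, hΦ, ← Matrix.toLin'_apply',
      LinearMap.toMatrix'_toLin']
  exact ⟨⟨Φ, hno, hno.isStable, hΦ, hirr⟩, fun Ψ hΨ => hΨ.isStable, ⟨Φ, hno⟩,
    P1.isZariskiOpen_hasNoInvariantSubbundle⟩
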